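/- Let $\mathbb{V}=\mathbb{C}^n$ with coordinatewise conjugation, the bilinear form $\langle \mathbf{z},\mathbf{w}\rangle_{\mathbb{R}}=\sum_k z_kw_k$ (orthogonality $\perp_{\mathbb{R}}$) and the canonical Hermitian norm $\|\cdot\|$. For an irreducible variety $X\subseteq\mathbb{V}$ of codimension $c$ with prime ideal $I_X=\langle f_1,\dots,f_s\rangle\subseteq\mathbb{C}[\mathbf{z}]$ and Jacobian matrix $J(f)$, let $I_{X_{\rm sing}}=I_X+\langle c\text{-minors of }J(f)\rangle$ and $X_{\rm reg}=X\setminus V(I_{X_{\rm sing}})$. On $\mathbb{C}[\mathbf{z},\mathbf{w},\mathbf{u},\mathbf{v}]$ let $*$ exchange $\mathbf{z}\leftrightarrow\mathbf{w}$, $\mathbf{u}\leftrightarrow\mathbf{v}$ and conjugate coefficients, and let $I'_X$ be generated by the $(c+1)$-minors of $\begin{bmatrix}\mathbf{v}-\mathbf{w}\\ J_{\mathbf{z}}(f)\end{bmatrix}$. The Hermitian critical ideal of $X$ is $$\bigl(I_X+(I_X)^*+I'_X+(I'_X)^*\bigr):\bigl(I_{X_{\rm sing}}\cdot(I_{X_{\rm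 sing}})^*\bigr)^{\infty}\subseteq\mathbb{C}[\mathbf{z},\mathbf{w},\mathbf{u},\mathbf{v}];$$ its solutions of $(\mathbf{u},\mathbf{v})\in\mathbb{V}^2$ are the $(\mathbf{z},\mathbf{w})$ such that $(\mathbf{z},\mathbf{w},\mathbf{u},\mathbf{v})$ is a zero of it. The number $\mathrm{vHD}(X)\in\mathbb{N}$ is the number of solutions for all $(\mathbf{u},\mathbf{v})$ outside some proper algebraic subset of $\mathbb{V}^2$. The set $\mathrm{HD}(X)\subseteq\mathbb{N}$ consists of the numbers $k$ such that, for all $\mathbf{u}$ in some non-empty open subset of $\mathbb{V}$, the function $q_{\mathbf{u}}(\mathbf{z})=\|\mathbf{u}-\mathbf{z}\|^2$ has exactly $k$ critical points on $X_{\rm reg}$. The dual variety is $X^\vee=\overline{\{\mathbf{s}\in\mathbb{V}\mid\exists\,\mathbf{z}\in X_{\rm reg}:\ \mathbf{s}\perp_{\mathbb{R}}T_{\mathbf{z}}X\}}^{Z}\subseteq\mathbb{V}$ (Zariski closure). **Theorem.** Let $X\subseteq\mathbb{V}$ be an irreducible affine cone (a Zariski closed set with prime ideal, stable under multiplication by scalars).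 1. For every $(\mathbf{u},\mathbf{v})\in\mathbb{V}^2$ the map $(\mathbf{z},\mathbf{w})\mapsto(\mathbf{v}-\mathbf{w},\mathbf{u}-\mathbf{z})$ is a bijection from the solutions of the Hermitian critical ideal of $X$ of $(\mathbf{u},\mathbf{v})$ to the solutions of the Hermitian critical ideal of $X^\vee$ of $(\mathbf{v},\mathbf{u})$. 2. The map sends critical points to critical points: for $\mathbf{v}=\bar{\mathbf{u}}$ it restricts to a bijection between the solutions with $\mathbf{w}=\bar{\mathbf{z}}$ on both sides. For every $\mathbf{u}$, each critical point $\mathbf{z}$ of $q_{\mathbf{u}}$ on $X_{\rm reg}$ gives such a solution $(\mathbf{z},\bar{\mathbf{z}})$; and for all $\mathbf{u}$ in a dense open subset of $\mathbb{V}$ the map $\mathbf{z}\mapsto\bar{\mathbf{u}}-\bar{\mathbf{z}}$ is a bijection from the critical points of $q_{\mathbf{u}}$ on $X_{\rm reg}$ to the critical points of $q_{\bar{\mathbf{u}}}$ on $(X^\vee)_{\rm reg}$. 3. The numbers $\mathrm{vHD}(X)$ and $\mathrm{vHD}(X^\vee)$ exist, $\mathrm{vHD}(X)=\mathrm{vHD}(X^\vee)$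 and $\mathrm{HD}(X)=\mathrm{HD}(X^\vee)$. 4. The map is proximity reversing for critical points: if $\mathbf{v}=\bar{\mathbf{u}}$ and $(\mathbf{z},\mathbf{w})$ is a solution with $\mathbf{w}=\bar{\mathbf{z}}$, then $\|\mathbf{u}-\mathbf{z}\|^2+\|\bar{\mathbf{u}}-(\bar{\mathbf{u}}-\mathbf{w})\|^2=\|\mathbf{u}-\mathbf{z}\|^2+\|\mathbf{z}\|^2=\|\mathbf{u}\|^2$; hence for two such solutions $(\mathbf{z},\mathbf{w})$, $(\mathbf{z}',\mathbf{w}')$ one has $\|\mathbf{u}-\mathbf{z}\|\le\|\mathbf{u}-\mathbf{z}'\|$ if and only if $\|\bar{\mathbf{u}}-(\bar{\mathbf{u}}-\mathbf{w}')\|\le\|\bar{\mathbf{u}}-(\bar{\mathbf{u}}-\mathbf{w})\|$. -/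

import Mathlib

open MvPolynomial

noncomputable section

namespace HermitianDistance

/-! The ambient space is `𝕍 = ℂⁿ` (type `Fin n → ℂ`) with the coordinatewise conjugation `star`,
the symmetric bilinear form `z ⬝ᵥ w = ∑ zᵢ wᵢ` and the canonical Hermitian norm `hnorm`. -/

/-- The norm of the canonical Hermitian inner product on `ℂⁿ`. -/
def hnorm {n : ℕ} (z : Fin n → ℂ) : ℝ := ‖(WithLp.toLp 2 z : EuclideanSpace ℂ (Fin n))‖

/-- The ideal `I_X` of all polynomials that vanish on `X`. -/
abbrev idealOf {n : ℕ} (X : Set (Fin n → ℂ)) : Ideal (MvPolynomial (Fin n) ℂ) :=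
  vanishingIdeal ℂ X

/-- Zariski closure. -/
def zariskiClosure {n : ℕ} (S : Set (Fin n → ℂ)) : Set (Fin n → ℂ) :=
  zeroLocus ℂ (idealOf S)

/-- `X ⊆ ℂⁿ` is an irreducible affine cone: a Zariski closed set whose ideal is prime and which is
stable under scalar multiplication. -/
structure IsIrreducibleAffineCone {n : ℕ} (X : Set (Fin n → ℂ)) : Prop where
  isClosed : zariskiClosure X = X
  isPrime : (idealOf X).IsPrime
  smul_mem : ∀ (a : ℂ), ∀ z ∈ X, a • z ∈ X

/-- The dimension of an (irreducible) variety: the transcendence degree of its coordinate ring. -/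
def dim {n : ℕ} (X : Set (Fin n → ℂ)) : ℕ :=
  Cardinal.toNat (Algebra.trdeg ℂ (MvPolynomial (Fin n) ℂ ⧸ idealOf X))

/-- The codimension in `ℂⁿ`. -/
def codim {n : ℕ} (X : Set (Fin n → ℂ)) : ℕ := n - dim X

/-- The `k`-minors of a matrix, up to sign and up to additional zeros. -/
def minors {R ι κ : Type*} [CommRing R] (k : ℕ) (M : Matrix ι κ R) : Set R :=
  {m | ∃ (r : Fin k → ι) (c : Fin k → κ), m = (M.submatrix r c).det}

/-- The Jacobian matrix `J(f)`. The rows are indexed by all `f ∈ I_X`; modulo `I_X`, every row is a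
combination of the rows that belong to a generating set `f₁, …, f_s`, so that the ideals of minors
below, which are always added to `I_X`, are the ones obtained from any set of generators. -/
def jacobian {n : ℕ} (X : Set (Fin n → ℂ)) :
    Matrix (idealOf X) (Fin n) (MvPolynomial (Fin n) ℂ) :=
  Matrix.of fun f j => pderiv j (f : MvPolynomial (Fin n) ℂ)

/-- The ideal `I_X + ⟨c-minors of J(f)⟩` of the singular locus, `c` the codimension. -/
def singIdeal {n : ℕ} (X : Set (Fin n → ℂ)) : Ideal (MvPolynomial (Fin n) ℂ) :=
  idealOf X ⊔ Ideal.span (minors (codim X) (jacobian X))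

/-- The regular locus `X_reg`. -/
def regLocus {n : ℕ} (X : Set (Fin n → ℂ)) : Set (Fin n → ℂ) :=
  X \ zeroLocus ℂ (singIdeal X)

/-- The (Zariski) tangent space `T_z X`. -/
def tangentSpace {n : ℕ} (X : Set (Fin n → ℂ)) (z : Fin n → ℂ) : Set (Fin n → ℂ) :=
  {t | ∀ f ∈ idealOf X, (fun j => eval z (pderiv j f)) ⬝ᵥ t = 0}

/-- The dual variety, seen in `ℂⁿ` through the bilinear form: the Zariski closure of the set of all
`s` that annihilate `T_z X` for some regular point `z`. -/
def dualVariety {n : ℕ} (X : Set (Fin n → ℂ)) : Set (Fin n → ℂ) :=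
  zariskiClosure {s | ∃ z ∈ regLocus X, ∀ t ∈ tangentSpace X z, s ⬝ᵥ t = 0}

/-! ### The Hermitian critical ideal -/

/-- The ring `ℂ[z, w, u, v]`: the variables `(0, i)`, `(1, i)`, `(2, i)`, `(3, i)` are
`zᵢ`, `wᵢ`, `uᵢ`, `vᵢ`. -/
abbrev Ring4 (n : ℕ) : Type := MvPolynomial (Fin 4 × Fin n) ℂ

/-- The inclusion `ℂ[z] → ℂ[z, w, u, v]`. -/
def inclZ (n : ℕ) : MvPolynomial (Fin n) ℂ →+* Ring4 n :=
  (rename (R := ℂ) (fun i : Fin n => ((0, i) : Fin 4 × Fin n))).toRingHom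

/-- The map `*` on `ℂ[z, w, u, v]`: it exchanges `z` with `w` and `u` with `v`, and conjugates the
coefficients. -/
def starMap (n : ℕ) : Ring4 n →+* Ring4 n :=
  (rename (R := ℂ) (fun p : Fin 4 × Fin n => ((![1, 0, 3, 2] : Fin 4 → Fin 4) p.1, p.2))).toRingHom.comp
    (MvPolynomial.map (starRingEnd ℂ))

/-- The matrix `J_z(f)` with the row `v - w` added on top. -/
def augmentedJacobian {n : ℕ} (X : Set (Fin n → ℂ)) :
    Matrix (Option (idealOf X)) (Fin n) (Ring4 n) :=
  Matrix.of fun o j =>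
    match o with
    | none => MvPolynomial.X (3, j) - MvPolynomial.X (1, j)
    | some f => inclZ n (jacobian X f j)

/-- The ideal `I'_X` generated by the `(c+1)`-minors of the augmented Jacobian matrix. -/
def augIdeal {n : ℕ} (X : Set (Fin n → ℂ)) : Ideal (Ring4 n) :=
  Ideal.span (minors (codim X + 1) (augmentedJacobian X))

/-- The saturation `I : J^∞`, the (increasing) union of the `I : J^k`. -/
def saturation {R : Type*} [CommRing R] (I J : Ideal R) : Ideal R :=
  ⨆ k : ℕ, Submodule.colon I ((J ^ k : Ideal R) : Set R)

/-- The Hermitian critical ideal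
`(I_X + I_X^* + I'_X + (I'_X)^*) : (I_{X_sing} ⬝ (I_{X_sing})^*)^∞` in `ℂ[z, w, u, v]`. -/
def criticalIdeal {n : ℕ} (X : Set (Fin n → ℂ)) : Ideal (Ring4 n) :=
  saturation
    ((idealOf X).map (inclZ n) ⊔ ((idealOf X).map (inclZ n)).map (starMap n) ⊔
      augIdeal X ⊔ (augIdeal X).map (starMap n))
    ((singIdeal X).map (inclZ n) * ((singIdeal X).map (inclZ n)).map (starMap n))

/-- The solutions `(z, w)` of the Hermitian critical ideal of `X` of `(u, v)`: the points for which
`(z, w, u, v)` is a zero of the ideal. -/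
def solutions {n : ℕ} (X : Set (Fin n → ℂ)) (u v : Fin n → ℂ) :
    Set ((Fin n → ℂ) × (Fin n → ℂ)) :=
  {p | (fun a : Fin 4 × Fin n => (![p.1, p.2, u, v] : Fin 4 → Fin n → ℂ) a.1 a.2) ∈
    zeroLocus ℂ (criticalIdeal X)}

/-- The solutions of the Hermitian critical ideal of `(u, ū)` with `w = z̄`. -/
def conjSolutions {n : ℕ} (X : Set (Fin n → ℂ)) (u : Fin n → ℂ) :
    Set ((Fin n → ℂ) × (Fin n → ℂ)) :=
  {p | p ∈ solutions X u (star u) ∧ p.2 = star p.1}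

/-- The critical points of `q_u(z) = ‖u - z‖²` on `X_reg`: the differential of `q_u` at `z`
vanishes on the tangent space. -/
def criticalPoints {n : ℕ} (X : Set (Fin n → ℂ)) (u : Fin n → ℂ) : Set (Fin n → ℂ) :=
  {z | z ∈ regLocus X ∧
    ∀ t ∈ tangentSpace X z, fderiv ℝ (fun x : Fin n → ℂ => hnorm (u - x) ^ 2) z t = 0}

/-! ### The two degrees -/

/-- For all `(u, v)` outside a proper algebraic subset of `𝕍²`, the Hermitian critical ideal of `X`
of `(u, v)` has exactly `k` solutions. (At most one `k` has this property.) -/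
def HasVHD {n : ℕ} (X : Set (Fin n → ℂ)) (k : ℕ) : Prop :=
  ∃ P : MvPolynomial (Fin n ⊕ Fin n) ℂ, P ≠ 0 ∧
    ∀ u v : Fin n → ℂ, eval (Sum.elim u v) P ≠ 0 → (solutions X u v).encard = k

/-- The virtual Hermitian Distance degree: the number of solutions for generic `(u, v)`. -/
def vHD {n : ℕ} (X : Set (Fin n → ℂ)) : ℕ := sInf {k | HasVHD X k}

/-- The Hermitian Distance degree: the set of all numbers of critical points of `q_u` that are
constant for `u` in some non-empty open set. -/
def HD {n : ℕ} (X : Set (Fin n → ℂ)) : Set ℕ :=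
  {k | ∃ U : Set (Fin n → ℂ), IsOpen U ∧ U.Nonempty ∧ ∀ u ∈ U, (criticalPoints X u).encard = k}

end HermitianDistance

end

/-! Everything reduces to the conormal variety `conormal X`, the Zariski closure of the pairs
(regular point z, vector s normal to X at z). Saturating by the singular ideals replaces a zero
locus by the closure of its part over regular points. In the coordinates p = (z, v - w) and p' =
(w̄, ū - z̄) this part is a product of two copies of the regular conormal pairs, and the closure of
a product is the product of the closures. Hence (z, w) is a solution for (u, v) exactly when (z, v -
w) and (w̄, ū - z̄) both lie in `conormal X` (`mem_solutions_iff`). The map of the theorem swaps the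
entries of these pairs, so the bijection is the biduality `mem_conormal_dualVariety_iff`: swapping
entries carries the conormal variety of X to that of its dual.

Biduality is proved at the generic point (x, s) of the conormal variety, over its function field. A
tangent vector t of the dual variety at s extends to a derivation D with Ds = t. Since X is a cone,
x ⬝ s = 0; since Dx is tangent to X at x, s ⬝ Dx = 0. Differentiating x ⬝ s = 0 leaves x ⬝ t = 0, so
x is normal to the dual at s (`mem_rowSpan_dualVariety`). This gives one inclusion of prime ideals.
Both quotients have transcendence degree n (`trdeg_conormal`), because the Jacobian has rank equal
to the codimension at the generic point, and so the inclusion is an equality.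

The closure of the regular critical points is irreducible of dimension at most 2n, so its projection
to (u, v) has a constant finite number of points over generic data (`exists_encard_fibre_eq`): this
is the virtual degree. The solutions at which a fixed maximal minor for X or for its dual vanishes
project into a proper hypersurface Q = 0, and Q(u, ū) ≠ 0 on a dense open set of u; there the
solutions with w = z̄ are the critical points on both regular loci. Proximity reversal is
Pythagoras: for w = z̄ and v = ū, the relation z ⬝ (ū - z̄) = 0 is Hermitian orthogonality of z and
u - z. -/

noncomputable section

namespace HermitianDistance

/-! ### Row spaces, annihilators and minors over a field -/

section LinearAlgebra

variable {K ι κ : Type*} [Field K] [Fintype κ]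

theorem dotProductBilin_nondegenerate :
    (dotProductBilin K K : (κ → K) →ₗ[K] (κ → K) →ₗ[K] K).Nondegenerate := by
  constructor
  · intro x hx
    exact dotProduct_eq_zero x hx
  · intro x hx
    exact dotProduct_eq_zero x fun y => by rw [dotProduct_comm]; exact hx y

theorem dotProductBilin_isRefl :
    (dotProductBilin K K : LinearMap.BilinForm K (κ → K)).IsRefl := by
  intro x y h
  simpa [dotProductBilin, dotProduct_comm] using h

/-- The row space of a matrix. -/
abbrev rowSpan {K ι κ : Type*} [Field K] (M : Matrix ι κ K) : Submodule K (κ → K) :=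
  Submodule.span K (Set.range M.row)

/-- The annihilator of a row space with respect to the dot product. -/
def dotAnnihilator (M : Matrix ι κ K) : Submodule K (κ → K) where
  carrier := {t | ∀ i, M i ⬝ᵥ t = 0}
  add_mem' ha hb i := by simp [ha i, hb i]
  zero_mem' i := by simp
  smul_mem' a x hx i := by simp [hx i]

theorem mem_dotAnnihilator {M : Matrix ι κ K} {t : κ → K} :
    t ∈ dotAnnihilator M ↔ ∀ i, M i ⬝ᵥ t = 0 := Iff.rfl

theorem dotAnnihilator_eq_orthogonal (M : Matrix ι κ K) :
    dotAnnihilator M = LinearMap.BilinForm.orthogonal (dotProductBilin K K)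
      (rowSpan M) := by
  ext t
  rw [LinearMap.BilinForm.mem_orthogonal_iff, mem_dotAnnihilator]
  constructor
  · intro h v hv
    induction hv using Submodule.span_induction with
    | mem x hx =>
      obtain ⟨i, rfl⟩ := hx
      exact h i
    | zero => exact zero_dotProduct t
    | add x y _ _ hx hy =>
      change (x + y) ⬝ᵥ t = 0
      rw [add_dotProduct]
      exact (congrArg₂ (· + ·) hx hy).trans (add_zero 0)
    | smul a x _ hx =>
      change (a • x) ⬝ᵥ t = 0
      rw [smul_dotProduct]
      exact (congrArg (a • ·) hx).trans (smul_zero a)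
  · intro h i
    exact h _ (Submodule.subset_span ⟨i, rfl⟩)

/-- A subspace is its own double orthogonal for the nondegenerate dot product. This translates
"annihilates the tangent space" into membership in the row space of the Jacobian. -/
theorem mem_span_range_iff_dotProduct (M : Matrix ι κ K) (s : κ → K) :
    s ∈ rowSpan M ↔ ∀ t, (∀ i, M i ⬝ᵥ t = 0) → s ⬝ᵥ t = 0 := by
  have h := LinearMap.BilinForm.orthogonal_orthogonal (B := dotProductBilin K K)
    dotProductBilin_nondegenerate dotProductBilin_isRefl (rowSpan M)
  rw [← h, ← dotAnnihilator_eq_orthogonal, LinearMap.BilinForm.mem_orthogonal_iff]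
  refine forall_congr' fun t => imp_congr Iff.rfl ?_
  change t ⬝ᵥ s = 0 ↔ s ⬝ᵥ t = 0
  rw [dotProduct_comm]

theorem finrank_dotAnnihilator (M : Matrix ι κ K) :
    Module.finrank K (dotAnnihilator M) =
      Fintype.card κ - Module.finrank K (rowSpan M) := by
  rw [dotAnnihilator_eq_orthogonal, LinearMap.BilinForm.finrank_orthogonal
    dotProductBilin_nondegenerate, Module.finrank_fintype_fun_eq_card]

omit [Fintype κ] in
theorem linearIndependent_of_minor_ne_zero {k : ℕ} {M : Matrix ι κ K} {r : Fin k → ι}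
    {c : Fin k → κ} (h : (M.submatrix r c).det ≠ 0) : LinearIndependent K (M.submatrix r id).row := by
  have h1 : LinearIndependent K (M.submatrix r c).row :=
    Matrix.linearIndependent_rows_iff_isUnit.2
      ((Matrix.isUnit_iff_isUnit_det _).2 (isUnit_iff_ne_zero.2 h))
  exact LinearIndependent.of_comp (LinearMap.funLeft K K c) h1

theorem le_finrank_of_minor_ne_zero {k : ℕ} {M : Matrix ι κ K} {r : Fin k → ι}
    {c : Fin k → κ} (h : (M.submatrix r c).det ≠ 0) :
    k ≤ Module.finrank K (rowSpan M) := by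
  have h1 := linearIndependent_of_minor_ne_zero h
  calc k = Module.finrank K (rowSpan (M.submatrix r id)) := by
        rw [finrank_span_eq_card h1, Fintype.card_fin]
    _ ≤ _ := Submodule.finrank_mono (Submodule.span_mono <| by
        rintro _ ⟨i, rfl⟩
        exact ⟨r i, rfl⟩)

theorem exists_minor_ne_zero_of_linearIndependent {k : ℕ} {M : Matrix (Fin k) κ K}
    (h : LinearIndependent K M.row) : ∃ c : Fin k → κ, (M.submatrix id c).det ≠ 0 := by
  have h1 : Module.finrank K (Submodule.span K (Set.range M.transpose)) = k := by
    have := h.rank_matrix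
    rw [Matrix.rank_eq_finrank_span_cols, Fintype.card_fin] at this
    exact this
  have h3 := Submodule.exists_fun_fin_finrank_span_eq K (Set.range M.transpose)
  rw [h1] at h3
  obtain ⟨f, hf, -, hli⟩ := h3
  choose c hc using hf
  refine ⟨c, ?_⟩
  have h2 : (M.submatrix id c).transpose = f := by
    ext i j
    rw [← hc]
    rfl
  rw [← Matrix.det_transpose]
  refine isUnit_iff_ne_zero.1 ((Matrix.isUnit_iff_isUnit_det _).1
    (Matrix.linearIndependent_rows_iff_isUnit.1 ?_))
  rw [h2]
  exact hli

theorem exists_minor_ne_zero {k : ℕ} {M : Matrix ι κ K}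
    (h : k ≤ Module.finrank K (rowSpan M)) :
    ∃ (r : Fin k → ι) (c : Fin k → κ), (M.submatrix r c).det ≠ 0 := by
  obtain ⟨f, hf, -, hli⟩ := Submodule.exists_fun_fin_finrank_span_eq K (Set.range M.row)
  choose r hr using hf
  have h1 : LinearIndependent K (M ∘ (r ∘ Fin.castLE h)) := by
    have : M ∘ (r ∘ Fin.castLE h) = f ∘ Fin.castLE h := by
      ext i : 1
      exact hr _
    rw [this]
    exact hli.comp _ (Fin.castLE_injective h)
  obtain ⟨c, hc⟩ := exists_minor_ne_zero_of_linearIndependent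
    (M := M.submatrix (r ∘ Fin.castLE h) id) h1
  exact ⟨r ∘ Fin.castLE h, c, hc⟩

/-- The matrix `M` with the row `s` added on top. -/
def addRow {R : Type*} (s : κ → R) (M : Matrix ι κ R) : Matrix (Option ι) κ R :=
  Matrix.of fun o j => o.elim (s j) fun i => M i j

/-- The enlarged matrix has rank at most `k`, while the `k` rows `r` are already independent; so
they span its whole row space, `s` included. -/
theorem mem_span_of_minors_eq_zero {k : ℕ} {s : κ → K} {M : Matrix ι κ K} {r : Fin k → ι}
    {c : Fin k → κ} (h : (M.submatrix r c).det ≠ 0)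
    (h0 : ∀ (r : Fin (k + 1) → Option ι) (c : Fin (k + 1) → κ),
      ((addRow s M).submatrix r c).det = 0) :
    s ∈ rowSpan (M.submatrix r id) := by
  have h1 : Module.finrank K (rowSpan (addRow s M)) ≤ k := by
    by_contra hk
    obtain ⟨r', c', h'⟩ := exists_minor_ne_zero (M := addRow s M) (k := k + 1) (by omega)
    exact h' (h0 r' c')
  have h2 : rowSpan (M.submatrix r id) ≤
      rowSpan (addRow s M) := by
    apply Submodule.span_mono
    rintro _ ⟨i, rfl⟩
    exact ⟨some (r i), rfl⟩
  have h3 : Module.finrank K (rowSpan (M.submatrix r id)) = k := by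
    rw [finrank_span_eq_card (linearIndependent_of_minor_ne_zero h), Fintype.card_fin]
  rw [Submodule.eq_of_le_of_finrank_le h2 (by omega)]
  exact Submodule.subset_span ⟨none, rfl⟩

theorem minor_eq_zero_of_mem_span {k : ℕ} {s : κ → K} {M : Matrix ι κ K}
    (hs : s ∈ rowSpan M)
    (hk : Module.finrank K (rowSpan M) ≤ k)
    (r : Fin (k + 1) → Option ι) (c : Fin (k + 1) → κ) :
    ((addRow s M).submatrix r c).det = 0 := by
  by_contra h
  have h1 := le_finrank_of_minor_ne_zero h
  have h2 : rowSpan (addRow s M) ≤ rowSpan M := by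
    rw [Submodule.span_le]
    rintro _ ⟨_ | i, rfl⟩
    · exact hs
    · exact Submodule.subset_span ⟨i, rfl⟩
  have := Submodule.finrank_mono h2
  omega

end LinearAlgebra

/-! ### Derivations of function fields and tangent vectors -/

section Derivations

open scoped TensorProduct

/-- Derivations extend to field extensions in characteristic zero. -/
theorem exists_derivation_extension {A K : Type} [CommRing A] [IsDomain A] [Field K] [Algebra ℂ A]
    [Algebra ℂ K] [Algebra A K] [IsScalarTower ℂ A K] [FaithfulSMul A K]
    [Algebra.EssFiniteType ℂ K] (D : Derivation ℂ A K) :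
    ∃ D' : Derivation ℂ K K, ∀ a, D' (algebraMap A K a) = D a := by
  let L := FractionRing A
  have : Algebra.FormallySmooth A L := .of_isLocalization (nonZeroDivisors A)
  let _ : Algebra L K := FractionRing.liftAlgebra A K
  have : IsScalarTower A L K := FractionRing.isScalarTower_liftAlgebra A K
  have : IsScalarTower ℂ L K := .of_algebraMap_eq fun x => by
    rw [IsScalarTower.algebraMap_apply ℂ A K, IsScalarTower.algebraMap_apply ℂ A L,
      ← IsScalarTower.algebraMap_apply A L K]
  have : Algebra.EssFiniteType L K := .of_comp ℂ L K
  have : CharZero L := charZero_of_injective_algebraMap (algebraMap ℂ L).injective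
  have : Algebra.FormallySmooth L K := inferInstance
  have : Algebra.FormallySmooth A K := .comp A L K
  -- Formal smoothness of K over A kills the first cotangent homology, the obstruction to
  -- injectivity. A K-linear retraction of the resulting injection then transports `D` to the
  -- differentials of K.
  have hinj : Function.Injective (KaehlerDifferential.mapBaseChange ℂ A K) := by
    rw [injective_iff_map_eq_zero]
    intro x hx
    obtain ⟨y, rfl⟩ := (Algebra.H1Cotangent.exact_δ_mapBaseChange ℂ A K x).1 hx
    rw [Subsingleton.elim y 0, map_zero]
  obtain ⟨g, hg⟩ := LinearMap.exists_leftInverse_of_injective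
    (KaehlerDifferential.mapBaseChange ℂ A K) (LinearMap.ker_eq_bot.2 hinj)
  let l : K ⊗[A] Ω[A⁄ℂ] →ₗ[K] K := LinearMap.liftBaseChange K D.liftKaehlerDifferential
  refine ⟨(l ∘ₗ g).compDer (KaehlerDifferential.D ℂ K), fun a => ?_⟩
  have h1 : KaehlerDifferential.D ℂ K (algebraMap A K a) =
      KaehlerDifferential.mapBaseChange ℂ A K (1 ⊗ₜ KaehlerDifferential.D ℂ A a) := by
    simp
  have h2 := LinearMap.congr_fun hg (1 ⊗ₜ[A] KaehlerDifferential.D ℂ A a)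
  simp only [LinearMap.comp_apply, LinearMap.id_apply] at h2
  change l (g (KaehlerDifferential.D ℂ K (algebraMap A K a))) = _
  rw [h1, h2]
  simp [l]

theorem derivation_aeval {σ K : Type} [Fintype σ] [CommRing K] [Algebra ℂ K] (D : Derivation ℂ K K)
    (x : σ → K) (f : MvPolynomial σ ℂ) :
    D (aeval x f) = (fun i => aeval x (pderiv i f)) ⬝ᵥ fun i => D (x i) := by
  classical
  induction f using MvPolynomial.induction_on with
  | C a => simp [dotProduct]
  | add p q hp hq => simp [hp, hq, dotProduct, add_mul, Finset.sum_add_distrib]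
  | mul_X p j hp =>
    simp only [map_mul, aeval_X, Derivation.leibniz, hp, smul_eq_mul, dotProduct, map_add,
      pderiv_X, Finset.mul_sum, add_mul, Finset.sum_add_distrib]
    congr 1
    · rw [Finset.sum_eq_single j]
      · simp [mul_comm]
      · intro i _ hi
        simp [hi.symm]
      · simp
    · refine Finset.sum_congr rfl fun i _ => ?_
      ring

/-- Since `t` kills the gradients of all relations of `x`, the directional derivative ∇f(x) ⬝ t
depends only on the value f(x). It is thus a derivation on ℂ[x], which extends to K. -/
theorem exists_derivation_of_tangent {σ K : Type} [Fintype σ] [Field K] [Algebra ℂ K]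
    [Algebra.EssFiniteType ℂ K] (x t : σ → K)
    (h : ∀ f : MvPolynomial σ ℂ, aeval x f = 0 → (fun i => aeval x (pderiv i f)) ⬝ᵥ t = 0) :
    ∃ D : Derivation ℂ K K, ∀ i, D (x i) = t i := by
  classical
  let A := (aeval x : MvPolynomial σ ℂ →ₐ[ℂ] K).range
  have hs (a : A) : ∃ f : MvPolynomial σ ℂ, aeval x f = (a : K) := a.2
  choose s hs using hs
  let d : MvPolynomial σ ℂ → K := fun f => (fun i => aeval x (pderiv i f)) ⬝ᵥ t
  have hd (f g : MvPolynomial σ ℂ) (hfg : (aeval x f : K) = aeval x g) : d f = d g := by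
    have := h (f - g) (by simp [hfg])
    simp only [map_sub] at this
    rw [← sub_eq_zero, ← this]
    simp [d, dotProduct, sub_mul]
  have hadd (f g) : d (f + g) = d f + d g := by
    simp [d, dotProduct, add_mul, Finset.sum_add_distrib]
  have hsmul (a : ℂ) (f) : d (a • f) = a • d f := by
    simp [d, dotProduct, Finset.smul_sum]
  have hmul (f g) : d (f * g) = aeval x f * d g + aeval x g * d f := by
    simp only [d, dotProduct, Derivation.leibniz, map_add, smul_eq_mul, map_mul, add_mul,
      Finset.sum_add_distrib, Finset.mul_sum, mul_assoc]
  let D₀ : Derivation ℂ A K := Derivation.mk'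
    { toFun := fun a => d (s a)
      map_add' := fun a b => by
        rw [← hadd]
        exact hd _ _ (by simp [hs])
      map_smul' := fun c a => by
        rw [RingHom.id_apply, ← hsmul]
        exact hd _ _ (by simp [hs]) }
    (fun a b => by
      change d (s (a * b)) = (a : K) * d (s b) + (b : K) * d (s a)
      rw [← hs a, ← hs b, ← hmul]
      exact hd _ _ (by simp [hs]))
  obtain ⟨D, hD⟩ := exists_derivation_extension D₀
  refine ⟨D, fun i => ?_⟩
  have h1 := hD ⟨x i, X i, by simp⟩
  change D (x i) = d _ at h1
  rw [h1, hd _ (X i) (by simp [hs])]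
  simp [d, dotProduct, pderiv_X, Pi.single_apply]

/-- In characteristic zero, a derivation that vanishes on `x` vanishes on all elements that are
algebraic over `x`. -/
theorem derivation_eq_zero_of_isAlgebraic {ι K : Type} [Field K] [Algebra ℂ K]
    (D : Derivation ℂ K K) (x : ι → K) (hx : ∀ i, D (x i) = 0)
    [Algebra.IsAlgebraic (Algebra.adjoin ℂ (Set.range x)) K] (a : K) : D a = 0 := by
  -- The constants of `D` form a field over which K is algebraic, hence separable. Applying `D` to
  -- the minimal polynomial of `a` gives minpoly'(a) · D a = 0 with nonzero first factor.
  let E : IntermediateField ℂ K :=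
    { carrier := {a | D a = 0}
      mul_mem' := fun {a b} ha hb => by
        simp only [Set.mem_ofPred_eq] at ha hb ⊢
        simp [ha, hb]
      add_mem' := fun {a b} ha hb => by
        simp only [Set.mem_ofPred_eq] at ha hb ⊢
        simp [ha, hb]
      algebraMap_mem' := fun r => by simp
      inv_mem' := fun a ha => by
        change D a = 0 at ha
        change D a⁻¹ = 0
        rw [Derivation.leibniz_inv, ha, smul_zero] }
  have hE : Algebra.adjoin ℂ (Set.range x) ≤ E.toSubalgebra := by
    rw [Algebra.adjoin_le_iff]
    rintro _ ⟨i, rfl⟩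
    exact hx i
  have : Algebra.IsAlgebraic E K := by
    constructor
    intro a
    have h1 := Algebra.IsAlgebraic.isAlgebraic (R := Algebra.adjoin ℂ (Set.range x)) a
    obtain ⟨p, hp, hpa⟩ := h1
    let i : Algebra.adjoin ℂ (Set.range x) →+* E := (Subalgebra.inclusion hE).toRingHom
    have hi : Function.Injective i := Subalgebra.inclusion_injective hE
    refine ⟨p.map i, (Polynomial.map_ne_zero_iff hi).2 hp, ?_⟩
    rw [Polynomial.aeval_def, Polynomial.eval₂_map]
    exact hpa
  let D' : Derivation E K K := Derivation.mk'
    { toFun := D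
      map_add' := fun a b => by simp
      map_smul' := fun c a => by
        have hc : D (c : K) = 0 := c.2
        change D ((c : K) * a) = (c : K) * D a
        simp [hc] }
    (fun a b => by simp)
  have h1 := D'.map_aeval (minpoly E a) a
  rw [minpoly.aeval, map_zero, smul_eq_mul, eq_comm, mul_eq_zero] at h1
  have h2 : IsSeparable E a := Algebra.IsSeparable.isSeparable E a
  exact h1.resolve_left (h2.aeval_derivative_ne_zero (minpoly.aeval E a))

/-- The vectors that are orthogonal to all gradients `∇f(x)` with `f(x) = 0`. Their number of
degrees of freedom is the transcendence degree. -/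
theorem finrank_dotAnnihilator_gradients {σ K : Type} [Fintype σ] [Field K] [Algebra ℂ K]
    [Algebra.EssFiniteType ℂ K] (x : σ → K)
    [Algebra.IsAlgebraic (Algebra.adjoin ℂ (Set.range x)) K] :
    Module.finrank K (dotAnnihilator <| Matrix.of
      fun (f : RingHom.ker (aeval (R := ℂ) x)) (i : σ) => (aeval x (pderiv i f.1) : K)) = Cardinal.toNat (Algebra.trdeg ℂ K) := by
  obtain ⟨S, hS, hb⟩ := exists_isTranscendenceBasis_subset (R := ℂ) (Set.range x)
  choose e he using hS
  let ind : S → σ := fun s => e s.2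
  have hind (s : S) : x (ind s) = s := he s.2
  have hfin : Finite S := (Set.finite_range x).subset (fun s hs => ⟨_, he hs⟩)
  have := Fintype.ofFinite S
  set T := dotAnnihilator <| Matrix.of
      fun (f : RingHom.ker (aeval (R := ℂ) x)) (i : σ) => (aeval x (pderiv i f.1) : K)
  -- Restriction to a transcendence basis chosen among the coordinates: a derivation is determined
  -- by its values there, and these values can be prescribed freely.
  let ρ : T →ₗ[K] (S → K) := (LinearMap.funLeft K K ind).comp T.subtype
  have hinj : Function.Injective ρ := by
    rw [injective_iff_map_eq_zero]
    rintro ⟨t, ht⟩ h0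
    obtain ⟨D, hD⟩ := exists_derivation_of_tangent x t fun f hf => ht ⟨f, hf⟩
    have h1 (s : S) : D (s : K) = 0 := by
      rw [← hind, hD]
      exact congrFun h0 s
    have := hb.isAlgebraic
    ext i
    refine (hD i).symm.trans ?_
    exact derivation_eq_zero_of_isAlgebraic D (Subtype.val : S → K) h1 (x i)
  have hsurj : Function.Surjective ρ := by
    intro τ
    obtain ⟨D, hD⟩ := exists_derivation_of_tangent (Subtype.val : S → K) τ fun f hf => by
      have : f = 0 := hb.1 (by rw [hf, map_zero])
      simp [this, dotProduct]
    refine ⟨⟨fun i => D (x i), fun f => ?_⟩, ?_⟩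
    · refine (derivation_aeval D x f.1).symm.trans ?_
      rw [show aeval x f.1 = 0 from f.2, map_zero]
    · ext s
      change D (x (ind s)) = _
      rw [hind, hD]
  rw [LinearEquiv.finrank_eq (LinearEquiv.ofBijective ρ ⟨hinj, hsurj⟩),
    Module.finrank_fintype_fun_eq_card, ← hb.cardinalMk_eq_trdeg]
  simp

end Derivations

/-! ### The rank of the Jacobian matrix at the generic point and elsewhere -/

section GenericRank

theorem isAlgebraic_adjoin_range_fractionRing {σ A : Type} [CommRing A] [IsDomain A] [Algebra ℂ A]
    (x : σ → A) (hx : Function.Surjective (aeval (R := ℂ) x)) :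
    Algebra.IsAlgebraic (Algebra.adjoin ℂ (Set.range (algebraMap A (FractionRing A) ∘ x)))
      (FractionRing A) := by
  have hmem (a : A) : algebraMap A (FractionRing A) a ∈
      Algebra.adjoin ℂ (Set.range (algebraMap A (FractionRing A) ∘ x)) := by
    obtain ⟨f, rfl⟩ := hx a
    rw [Algebra.adjoin_range_eq_range_aeval]
    refine ⟨f, ?_⟩
    rw [Function.comp_def]
    exact (aeval_algebraMap_apply (FractionRing A) x f)
  let i : A →+* Algebra.adjoin ℂ (Set.range (algebraMap A (FractionRing A) ∘ x)) :=
    (algebraMap A (FractionRing A)).codRestrict _ hmem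
  have hi : Function.Injective i := fun a b h =>
    IsFractionRing.injective A (FractionRing A) (congrArg Subtype.val h)
  have := IsLocalization.isAlgebraic (S := FractionRing A) (nonZeroDivisors A)
  constructor
  intro a
  obtain ⟨p, hp, hpa⟩ := Algebra.IsAlgebraic.isAlgebraic (R := A) a
  refine ⟨p.map i, (Polynomial.map_ne_zero_iff hi).2 hp, ?_⟩
  rw [Polynomial.aeval_def, Polynomial.eval₂_map]
  exact hpa

theorem trdeg_fractionRing (A : Type) [CommRing A] [IsDomain A] [Algebra ℂ A] :
    Algebra.trdeg ℂ (FractionRing A) = Algebra.trdeg ℂ A := by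
  have := IsLocalization.isAlgebraic (S := FractionRing A) (nonZeroDivisors A)
  rw [← trdeg_add_eq ℂ A, trdeg_eq_zero (R := A), add_zero]

/-- The generic point of the variety of a prime ideal. -/
def genericPoint {σ : Type} (I : Ideal (MvPolynomial σ ℂ)) (i : σ) :
    FractionRing (MvPolynomial σ ℂ ⧸ I) :=
  algebraMap _ _ (Ideal.Quotient.mk I (MvPolynomial.X i))

theorem aeval_genericPoint {σ : Type} (I : Ideal (MvPolynomial σ ℂ)) (f : MvPolynomial σ ℂ) :
    aeval (genericPoint I) f = algebraMap _ (FractionRing (MvPolynomial σ ℂ ⧸ I))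
      (Ideal.Quotient.mk I f) := by
  have : (aeval (genericPoint I) : MvPolynomial σ ℂ →ₐ[ℂ] _) =
      (IsScalarTower.toAlgHom ℂ (MvPolynomial σ ℂ ⧸ I) (FractionRing _)).comp
        (Ideal.Quotient.mkₐ ℂ I) := by
    ext i
    simp [genericPoint]
  rw [this]
  rfl

theorem aeval_genericPoint_eq_zero_iff {σ : Type} (I : Ideal (MvPolynomial σ ℂ))
    (f : MvPolynomial σ ℂ) : aeval (genericPoint I) f = 0 ↔ f ∈ I := by
  rw [aeval_genericPoint, FaithfulSMul.algebraMap_eq_zero_iff, Ideal.Quotient.eq_zero_iff_mem]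

theorem essFiniteType_fractionRing {σ : Type} [Finite σ] (I : Ideal (MvPolynomial σ ℂ)) :
    Algebra.EssFiniteType ℂ (FractionRing (MvPolynomial σ ℂ ⧸ I)) := by
  have : Algebra.EssFiniteType (MvPolynomial σ ℂ ⧸ I) (FractionRing (MvPolynomial σ ℂ ⧸ I)) :=
    .of_isLocalization _ (nonZeroDivisors _)
  exact .comp ℂ (MvPolynomial σ ℂ ⧸ I) _

variable {n : ℕ} (X : Set (Fin n → ℂ))

/-- The Jacobian matrix at a point with coordinates in a `ℂ`-algebra. -/
def jacAt {A : Type*} [CommRing A] [Algebra ℂ A] (x : Fin n → A) :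
    Matrix (idealOf X) (Fin n) A :=
  (jacobian X).map (aeval x)

theorem jacAt_apply {A : Type*} [CommRing A] [Algebra ℂ A] (x : Fin n → A) (f : idealOf X)
    (j : Fin n) : jacAt X x f j = aeval x (pderiv j (f : MvPolynomial (Fin n) ℂ)) := rfl

theorem det_jacAt {A : Type*} [CommRing A] [Algebra ℂ A] (x : Fin n → A) {k : ℕ}
    (r : Fin k → idealOf X) (c : Fin k → Fin n) :
    ((jacAt X x).submatrix r c).det = aeval x ((jacobian X).submatrix r c).det := by
  rw [AlgHom.map_det]
  rfl

variable [hp : (idealOf X).IsPrime]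

/-- The annihilator of the gradients at the generic point has dimension the transcendence degree,
which is dim X; rank and nullity add up to n. -/
theorem finrank_jacAt_genericPoint :
    Module.finrank (FractionRing (MvPolynomial (Fin n) ℂ ⧸ idealOf X))
      (rowSpan (jacAt X (genericPoint (idealOf X)))) = codim X := by
  set A := MvPolynomial (Fin n) ℂ ⧸ idealOf X with hA
  set K := FractionRing A with hK
  have : Algebra.EssFiniteType ℂ K := essFiniteType_fractionRing (idealOf X)
  have h0 : Algebra.IsAlgebraic (Algebra.adjoin ℂ (Set.range (genericPoint (idealOf X)))) K := by
    refine isAlgebraic_adjoin_range_fractionRing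
      (fun i => Ideal.Quotient.mk (idealOf X) (MvPolynomial.X i)) fun a => ?_
    obtain ⟨f, rfl⟩ := Ideal.Quotient.mk_surjective a
    refine ⟨f, ?_⟩
    change aeval (fun i => Ideal.Quotient.mkₐ ℂ (idealOf X) (MvPolynomial.X i)) f = _
    exact (DFunLike.congr_fun (aeval_unique (Ideal.Quotient.mkₐ ℂ (idealOf X))) f).symm
  have h1 := finrank_dotAnnihilator_gradients (genericPoint (idealOf X))
  have h2 : (dotAnnihilator <| Matrix.of fun (f : RingHom.ker (aeval (R := ℂ) (genericPoint (idealOf X))))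
      (i : Fin n) => (aeval (genericPoint (idealOf X)) (pderiv i f.1) : K)) = dotAnnihilator (jacAt X (genericPoint (idealOf X))) := by
    ext t
    refine ⟨fun h f => h ⟨f, (aeval_genericPoint_eq_zero_iff (idealOf X) _).2 f.2⟩, fun h f =>
      h ⟨f, (aeval_genericPoint_eq_zero_iff (idealOf X) _).1 f.2⟩⟩
  rw [h2, finrank_dotAnnihilator, Fintype.card_fin, trdeg_fractionRing] at h1
  -- Needed because `codim` is a truncated subtraction: n - (n - rank) = rank only if rank ≤ n.
  have h3 : Module.finrank K (rowSpan (jacAt X (genericPoint (idealOf X)))) ≤ n := by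
    simpa using Submodule.finrank_le (rowSpan (jacAt X (genericPoint (idealOf X))))
  rw [codim, dim, ← h1]
  exact (Nat.sub_sub_self h3).symm

theorem jacobian_minor_mem (r : Fin (codim X + 1) → idealOf X) (c : Fin (codim X + 1) → Fin n) :
    ((jacobian X).submatrix r c).det ∈ idealOf X := by
  by_contra h
  rw [← aeval_genericPoint_eq_zero_iff, ← det_jacAt] at h
  have := le_finrank_of_minor_ne_zero h
  rw [finrank_jacAt_genericPoint] at this
  omega

theorem exists_jacobian_minor_notMem : ∃ (r : Fin (codim X) → idealOf X)
    (c : Fin (codim X) → Fin n), ((jacobian X).submatrix r c).det ∉ idealOf X := by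
  obtain ⟨r, c, h⟩ := exists_minor_ne_zero (finrank_jacAt_genericPoint X).ge
  exact ⟨r, c, by rwa [← aeval_genericPoint_eq_zero_iff, ← det_jacAt]⟩

/-- The rank of the Jacobian matrix is at most the codimension, at every point. -/
theorem finrank_jacAt_le {K : Type*} [Field K] [Algebra ℂ K] (x : Fin n → K)
    (hx : ∀ f ∈ idealOf X, aeval x f = 0) :
    Module.finrank K (rowSpan (jacAt X x)) ≤ codim X := by
  by_contra h
  obtain ⟨r, c, hrc⟩ := exists_minor_ne_zero (M := jacAt X x) (k := codim X + 1) (by omega)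
  rw [det_jacAt] at hrc
  exact hrc (hx _ (jacobian_minor_mem X r c))

/-- Where a maximal minor does not vanish, its rows span the row space. -/
theorem span_jacAt_eq {K : Type*} [Field K] [Algebra ℂ K] {x : Fin n → K}
    (hx : ∀ f ∈ idealOf X, aeval x f = 0) {r : Fin (codim X) → idealOf X}
    {c : Fin (codim X) → Fin n} (h : aeval x ((jacobian X).submatrix r c).det ≠ 0) :
    rowSpan ((jacAt X x).submatrix r id) = (rowSpan (jacAt X x)) := by
  rw [← det_jacAt] at h
  apply Submodule.eq_of_le_of_finrank_le
    (Submodule.span_mono <| by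
      rintro _ ⟨i, rfl⟩
      exact ⟨r i, rfl⟩)
  rw [finrank_span_eq_card (linearIndependent_of_minor_ne_zero h), Fintype.card_fin]
  exact finrank_jacAt_le X x hx

end GenericRank

/-! ### Regular points and normal spaces -/

section RegularLocus

variable {n : ℕ} {X : Set (Fin n → ℂ)}

theorem mem_regLocus_iff {z : Fin n → ℂ} : z ∈ regLocus X ↔ z ∈ X ∧
    ∃ (r : Fin (codim X) → idealOf X) (c : Fin (codim X) → Fin n),
      aeval z ((jacobian X).submatrix r c).det ≠ 0 := by
  rw [regLocus, Set.mem_sdiff]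
  refine and_congr_right fun hz => ?_
  rw [mem_zeroLocus_iff, not_iff_comm]
  push Not
  constructor
  · intro h p hp
    have hle : singIdeal X ≤ RingHom.ker (aeval z : MvPolynomial (Fin n) ℂ →ₐ[ℂ] ℂ) := by
      refine sup_le (fun f hf => hf z hz) (Ideal.span_le.2 ?_)
      rintro _ ⟨r, c, rfl⟩
      exact h r c
    exact hle hp
  · intro h r c
    exact h _ (Ideal.mem_sup_right (Ideal.subset_span ⟨r, c, rfl⟩))

/-- The normal space of `X` at `z`. -/
def normalSpace (X : Set (Fin n → ℂ)) (z : Fin n → ℂ) : Submodule ℂ (Fin n → ℂ) :=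
  (rowSpan (jacAt X z))

theorem mem_normalSpace_iff {z s : Fin n → ℂ} :
    s ∈ normalSpace X z ↔ ∀ t ∈ tangentSpace X z, s ⬝ᵥ t = 0 := by
  rw [normalSpace, mem_span_range_iff_dotProduct]
  refine forall_congr' fun t => imp_congr ?_ Iff.rfl
  exact ⟨fun h f hf => h ⟨f, hf⟩, fun h f => h f f.2⟩

end RegularLocus

/-! ### The conormal variety: irreducibility and dimension -/

section Conormal

variable {n : ℕ} {X : Set (Fin n → ℂ)}

/-- The pairs of a regular point and a normal vector at this point. -/
def regConormal (X : Set (Fin n → ℂ)) : Set (Fin n ⊕ Fin n → ℂ) :=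
  {p | p ∘ Sum.inl ∈ regLocus X ∧ p ∘ Sum.inr ∈ normalSpace X (p ∘ Sum.inl)}

/-- The conormal variety. -/
def conormal (X : Set (Fin n → ℂ)) : Set (Fin n ⊕ Fin n → ℂ) :=
  zeroLocus ℂ (vanishingIdeal ℂ (regConormal X))

/-- The parametrization `(z, l) ↦ (z, ∑ lⱼ ∇fⱼ(z))` of the conormal variety. -/
def conormalParam {k : ℕ} (r : Fin k → idealOf X) : MvPolynomial (Fin n ⊕ Fin n) ℂ →ₐ[ℂ]
    MvPolynomial (Fin k) (MvPolynomial (Fin n) ℂ ⧸ idealOf X) :=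
  aeval (Sum.elim (fun i => C (Ideal.Quotient.mk _ (MvPolynomial.X i))) fun i =>
    ∑ j, MvPolynomial.X j * C (Ideal.Quotient.mk _ (pderiv i (r j : MvPolynomial (Fin n) ℂ))))

/-- The evaluation of the coordinate ring at a point of `X`. -/
def evalPoint {z : Fin n → ℂ} (hz : z ∈ X) : MvPolynomial (Fin n) ℂ ⧸ idealOf X →+* ℂ :=
  Ideal.Quotient.lift (idealOf X) (aeval z : MvPolynomial (Fin n) ℂ →ₐ[ℂ] ℂ).toRingHom
    fun _ hf => hf z hz

theorem evalPoint_mk {z : Fin n → ℂ} (hz : z ∈ X) (f : MvPolynomial (Fin n) ℂ) :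
    evalPoint hz (Ideal.Quotient.mk _ f) = aeval z f := rfl

theorem evalPoint_conormalParam {k : ℕ} (r : Fin k → idealOf X) {z : Fin n → ℂ} (hz : z ∈ X)
    (l : Fin k → ℂ) (F : MvPolynomial (Fin n ⊕ Fin n) ℂ) :
    eval₂Hom (evalPoint hz) l (conormalParam r F) =
      aeval (Sum.elim z (∑ j, l j • (jacAt X z).row (r j))) F := by
  rw [conormalParam]
  induction F using MvPolynomial.induction_on with
  | C a =>
    rw [algHom_C, algHom_C]
    change eval₂Hom (evalPoint hz) l (C (Ideal.Quotient.mk _ (C a))) = _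
    rw [coe_eval₂Hom, eval₂_C, evalPoint_mk, algHom_C]
  | add p q hp hq => rw [map_add, map_add, map_add, hp, hq]
  | mul_X p i hp =>
    rw [map_mul, map_mul, map_mul, hp]
    congr 1
    rw [aeval_X, aeval_X]
    rcases i with i | i
    · simp [evalPoint_mk]
    · simp [evalPoint_mk, jacAt_apply, Matrix.row]

/-- For fixed z a complex polynomial in l is determined by its values, and a coefficient in ℂ[X] is
determined by its values at the points z of X. -/
theorem eq_zero_of_evalPoint_eq_zero {k : ℕ}
    (F : MvPolynomial (Fin k) (MvPolynomial (Fin n) ℂ ⧸ idealOf X))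
    (h : ∀ (z : Fin n → ℂ) (hz : z ∈ X) (l : Fin k → ℂ), eval₂Hom (evalPoint hz) l F = 0) :
    F = 0 := by
  ext m
  obtain ⟨f, hf⟩ := Ideal.Quotient.mk_surjective (F.coeff m)
  rw [coeff_zero, ← hf, Ideal.Quotient.eq_zero_iff_mem]
  intro z hz
  rw [← evalPoint_mk hz, hf, ← coeff_map]
  have : map (evalPoint hz) F = 0 := by
    refine MvPolynomial.funext fun l => ?_
    rw [eval_map, map_zero]
    exact h z hz l
  rw [this, coeff_zero]

theorem exists_coeff_of_mem_normalSpace (hp : (idealOf X).IsPrime) {z s : Fin n → ℂ} (hz : z ∈ X)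
    {r : Fin (codim X) → idealOf X} {c : Fin (codim X) → Fin n}
    (h : aeval z ((jacobian X).submatrix r c).det ≠ 0) (hs : s ∈ normalSpace X z) :
    ∃ l : Fin (codim X) → ℂ, s = ∑ j, l j • (jacAt X z).row (r j) := by
  rw [normalSpace, ← span_jacAt_eq X (fun f hf => hf z hz) h,
    Submodule.mem_span_range_iff_exists_fun] at hs
  obtain ⟨l, hl⟩ := hs
  exact ⟨l, hl.symm⟩

theorem sum_smul_row_mem_normalSpace {k : ℕ} (z : Fin n → ℂ) (r : Fin k → idealOf X)
    (l : Fin k → ℂ) : ∑ j, l j • (jacAt X z).row (r j) ∈ normalSpace X z :=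
  Submodule.sum_mem _ fun _ _ => Submodule.smul_mem _ _ (Submodule.subset_span ⟨_, rfl⟩)

theorem mem_regConormal_iff {p : Fin n ⊕ Fin n → ℂ} : p ∈ regConormal X ↔
    p ∘ Sum.inl ∈ regLocus X ∧ p ∘ Sum.inr ∈ normalSpace X (p ∘ Sum.inl) := Iff.rfl

theorem elim_mem_regConormal {z s : Fin n → ℂ} (hz : z ∈ regLocus X) (hs : s ∈ normalSpace X z) :
    Sum.elim z s ∈ regConormal X := by
  rw [mem_regConormal_iff, Sum.elim_comp_inl, Sum.elim_comp_inr]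
  exact ⟨hz, hs⟩

/-- Where the minor Δ is nonzero, the gradients `r` span the normal space, so the parametrization
reaches every normal vector. Points with Δ = 0 are handled by multiplying with Δ, which cancels in a
domain. Being the kernel of a map to a domain, the ideal is prime. -/
theorem vanishingIdeal_regConormal (hp : (idealOf X).IsPrime)
    {r : Fin (codim X) → idealOf X} {c : Fin (codim X) → Fin n}
    (h : ((jacobian X).submatrix r c).det ∉ idealOf X) :
    vanishingIdeal ℂ (regConormal X) = RingHom.ker (conormalParam r) := by
  set Δ := ((jacobian X).submatrix r c).det
  have hΔ : (C (Ideal.Quotient.mk _ Δ) :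
      MvPolynomial (Fin (codim X)) (MvPolynomial (Fin n) ℂ ⧸ idealOf X)) ≠ 0 := by
    rwa [Ne, C_eq_zero, Ideal.Quotient.eq_zero_iff_mem]
  ext F
  rw [RingHom.mem_ker, mem_vanishingIdeal_iff]
  constructor
  · intro hF
    refine (mul_eq_zero.1 (eq_zero_of_evalPoint_eq_zero
      (C (Ideal.Quotient.mk _ Δ) * conormalParam r F) fun z hz l => ?_)).resolve_left hΔ
    rw [map_mul, evalPoint_conormalParam]
    by_cases hz0 : aeval z Δ = 0
    · simp [evalPoint_mk, hz0]
    · rw [hF _ (elim_mem_regConormal (mem_regLocus_iff.2 ⟨hz, r, c, hz0⟩)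
        (sum_smul_row_mem_normalSpace z r l)), mul_zero]
  · rintro hF p ⟨hp1, hp2⟩
    obtain ⟨hz, r', c', h'⟩ := mem_regLocus_iff.1 hp1
    obtain ⟨l, hl⟩ := exists_coeff_of_mem_normalSpace hp hz h' hp2
    -- A regular point may be detected only by another minor, with rows `r'`. Over Δ ≠ 0
    -- combinations of the rows `r'` are combinations of the rows `r`, so `F` dies under both
    -- parametrizations.
    have h1 : conormalParam r' F = 0 := by
      refine (mul_eq_zero.1 (eq_zero_of_evalPoint_eq_zero
        (C (Ideal.Quotient.mk _ Δ) * conormalParam r' F) fun z hz l => ?_)).resolve_left hΔ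
      rw [map_mul, evalPoint_conormalParam]
      by_cases hz0 : aeval z Δ = 0
      · simp [evalPoint_mk, hz0]
      · obtain ⟨l', hl'⟩ := exists_coeff_of_mem_normalSpace hp hz hz0
          (sum_smul_row_mem_normalSpace z r' l)
        rw [hl', ← evalPoint_conormalParam r hz, hF, map_zero, mul_zero]
    have h2 := evalPoint_conormalParam r' hz l F
    rw [h1, map_zero, ← hl, Sum.elim_comp_inl_inr] at h2
    exact h2.symm

variable (X) in
theorem vanishingIdeal_regConormal_isPrime [hp : (idealOf X).IsPrime] :
    (vanishingIdeal ℂ (regConormal X)).IsPrime := by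
  obtain ⟨r, c, h⟩ := exists_jacobian_minor_notMem X
  rw [vanishingIdeal_regConormal hp h]
  exact RingHom.ker_isPrime _

/-- Cramer's rule: the parameters `l` are recovered from the normal vector up to the determinant of
the chosen minor. -/
theorem map_det_mul_eq_of_vecMul_eq {A R κ : Type*} [CommRing A] [CommRing R] [Fintype κ]
    [DecidableEq κ] (i : A →+* R) (N : Matrix κ κ A) (l : κ → R) (s : κ → A)
    (h : Matrix.vecMul l (N.map i) = i ∘ s) (a : κ) :
    i N.det * l a = i (Matrix.vecMul s N.adjugate a) := by
  have h1 : i N.det = (N.map i).det := i.map_det N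
  have h2 : (N.map i).adjugate = N.adjugate.map i := (i.map_adjugate N).symm
  have h3 : Matrix.vecMul l (N.map i * (N.map i).adjugate) a = (N.map i).det * l a := by
    rw [Matrix.mul_adjugate, Matrix.vecMul_smul, Matrix.vecMul_one]
    rfl
  rw [h1, ← h3, ← Matrix.vecMul_vecMul, h, h2, RingHom.map_vecMul]

theorem isAlgebraic_of_mul_eq {A R : Type*} [CommRing A] [CommRing R] [Algebra A R] {d u : A}
    {y : R} (hd : d ≠ 0) (h : algebraMap A R d * y = algebraMap A R u) : IsAlgebraic A y := by
  refine ⟨Polynomial.C d * Polynomial.X - Polynomial.C u, fun h0 => ?_, ?_⟩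
  · have := congrArg (fun q => Polynomial.coeff q 1) h0
    simp [Polynomial.coeff_C] at this
    exact hd this
  · rw [map_sub, map_mul, Polynomial.aeval_C, Polynomial.aeval_X, Polynomial.aeval_C, h, sub_self]

theorem isAlgebraic_mvPolynomial {A B κ : Type*} [CommRing A] [IsDomain A] [CommRing B]
    [Algebra A (MvPolynomial κ B)]
    (hC : ∀ b : B, IsAlgebraic A (C b : MvPolynomial κ B))
    (hX : ∀ k, IsAlgebraic A (MvPolynomial.X k : MvPolynomial κ B)) :
    Algebra.IsAlgebraic A (MvPolynomial κ B) := by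
  constructor
  intro p
  induction p using MvPolynomial.induction_on with
  | C b => exact hC b
  | add p q hp hq => exact hp.add hq
  | mul_X p a hp => exact hp.mul (hX a)

/-- The functions on X already come from `A`, and by Cramer's rule each parameter is a root of a
linear polynomial over `A` with leading coefficient the nonzero minor. The parametrization therefore
preserves dimension. -/
theorem isAlgebraic_conormalRing {A : Type*} [CommRing A] [IsDomain A] [Algebra ℂ A]
    {r : Fin (codim X) → idealOf X} {c : Fin (codim X) → Fin n}
    (h : ((jacobian X).submatrix r c).det ∉ idealOf X)
    (i : A →ₐ[ℂ] MvPolynomial (Fin (codim X)) (MvPolynomial (Fin n) ℂ ⧸ idealOf X))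
    (x s : Fin n → A)
    (hx : ∀ j, i (x j) = C (Ideal.Quotient.mk _ (MvPolynomial.X j)))
    (hs : ∀ j, i (s j) =
      ∑ a, MvPolynomial.X a * C (Ideal.Quotient.mk _ (pderiv j (r a : MvPolynomial (Fin n) ℂ)))) :
    letI := i.toRingHom.toAlgebra
    Algebra.IsAlgebraic A
      (MvPolynomial (Fin (codim X)) (MvPolynomial (Fin n) ℂ ⧸ idealOf X)) := by
  algebraize [i.toRingHom]
  let N : Matrix (Fin (codim X)) (Fin (codim X)) A := (jacAt X x).submatrix r c
  have hx' (f : MvPolynomial (Fin n) ℂ) : i (aeval x f) = C (Ideal.Quotient.mk _ f) := by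
    induction f using MvPolynomial.induction_on with
    | C a => rw [algHom_C, AlgHom.commutes]; rfl
    | add p q hp hq => simp only [map_add, hp, hq]
    | mul_X p j hp => simp only [map_mul, hp, aeval_X, hx]
  have hdet : i N.det = C (Ideal.Quotient.mk _ ((jacobian X).submatrix r c).det) := by
    rw [← hx', ← det_jacAt]
  have hvec : Matrix.vecMul MvPolynomial.X (N.map i.toRingHom) =
      i.toRingHom ∘ fun b => s (c b) := by
    ext1 b
    refine Eq.trans ?_ (hs (c b)).symm
    rw [Matrix.vecMul, dotProduct]
    refine Finset.sum_congr rfl fun a _ => ?_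
    congr 1
    exact hx' (pderiv (c b) (r a).1)
  have hdet0 : N.det ≠ 0 := fun h0 => by
    rw [h0, map_zero, eq_comm, C_eq_zero, Ideal.Quotient.eq_zero_iff_mem] at hdet
    exact h hdet
  refine isAlgebraic_mvPolynomial (fun b => ?_) fun a => ?_
  swap
  · have key := map_det_mul_eq_of_vecMul_eq
      (R := MvPolynomial (Fin (codim X)) (MvPolynomial (Fin n) ℂ ⧸ idealOf X))
      i.toRingHom N MvPolynomial.X (fun b => s (c b)) hvec a
    exact isAlgebraic_of_mul_eq hdet0 key
  obtain ⟨f, rfl⟩ := Ideal.Quotient.mk_surjective b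
  rw [← hx']
  exact isAlgebraic_algebraMap (aeval x f)

theorem trdeg_eq_of_isAlgebraic {A R : Type} [CommRing A] [CommRing R] [IsDomain R] [Algebra ℂ A]
    [Algebra ℂ R] (i : A →ₐ[ℂ] R) (hi : Function.Injective i) (h : letI := i.toRingHom.toAlgebra; Algebra.IsAlgebraic A R) :
    Algebra.trdeg ℂ A = Algebra.trdeg ℂ R := by
  algebraize [i.toRingHom]
  have : FaithfulSMul A R := (faithfulSMul_iff_algebraMap_injective A R).2 hi
  have : IsScalarTower ℂ A R := .of_algebraMap_eq fun x => (i.commutes x).symm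
  have : Nontrivial A := (i : A →+* R).domain_nontrivial
  have : Algebra.IsAlgebraic A R := h
  rw [← trdeg_add_eq ℂ A (A := R), trdeg_eq_zero (R := A), add_zero]

theorem trdeg_quotient_ker_conormalParam [hp : (idealOf X).IsPrime]
    {r : Fin (codim X) → idealOf X} {c : Fin (codim X) → Fin n}
    (h : ((jacobian X).submatrix r c).det ∉ idealOf X) :
    Algebra.trdeg ℂ (MvPolynomial (Fin n ⊕ Fin n) ℂ ⧸ RingHom.ker (conormalParam r)) =
      Algebra.trdeg ℂ (MvPolynomial (Fin n) ℂ ⧸ idealOf X) + codim X := by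
  have hprime : (RingHom.ker (conormalParam r)).IsPrime := RingHom.ker_isPrime _
  have h1 := isAlgebraic_conormalRing h (Ideal.kerLiftAlg (conormalParam r))
    (fun j => Ideal.Quotient.mk _ (MvPolynomial.X (Sum.inl j)))
    (fun j => Ideal.Quotient.mk _ (MvPolynomial.X (Sum.inr j)))
    (fun j => by rw [Ideal.kerLiftAlg_mk, conormalParam, aeval_X, Sum.elim_inl])
    (fun j => by rw [Ideal.kerLiftAlg_mk, conormalParam, aeval_X, Sum.elim_inr])
  have h2 := trdeg_eq_of_isAlgebraic
    (R := MvPolynomial (Fin (codim X)) (MvPolynomial (Fin n) ℂ ⧸ idealOf X))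
    (Ideal.kerLiftAlg (conormalParam r)) (Ideal.kerLiftAlg_injective (conormalParam r)) h1
  rw [h2, ← trdeg_add_eq ℂ (MvPolynomial (Fin n) ℂ ⧸ idealOf X), MvPolynomial.trdeg_of_isDomain]
  simp

/-- The conormal variety has dimension `n`. -/
theorem trdeg_conormal (X : Set (Fin n → ℂ)) [hp : (idealOf X).IsPrime] :
    Algebra.trdeg ℂ (MvPolynomial (Fin n ⊕ Fin n) ℂ ⧸ vanishingIdeal ℂ (regConormal X)) = n := by
  obtain ⟨r, c, h⟩ := exists_jacobian_minor_notMem X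
  have h0 := trdeg_quotient_ker_conormalParam h
  rw [← vanishingIdeal_regConormal hp h] at h0
  -- Guards against the default value of `Cardinal.toNat` at infinite cardinals and against
  -- truncation in n - dim X.
  have hle : Algebra.trdeg ℂ (MvPolynomial (Fin n) ℂ ⧸ idealOf X) ≤ n := by
    have h1 := trdeg_le_of_surjective (R := ℂ)
      (Ideal.Quotient.mkₐ ℂ (idealOf X)) (Ideal.Quotient.mkₐ_surjective ℂ (idealOf X))
    rwa [MvPolynomial.trdeg_of_isDomain, Cardinal.mk_fin, Cardinal.lift_natCast] at h1
  obtain ⟨d, hd⟩ := Cardinal.lt_aleph0.1 (hle.trans_lt Cardinal.natCast_lt_aleph0)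
  rw [h0, codim, dim, hd, Cardinal.toNat_natCast]
  rw [hd, Nat.cast_le] at hle
  rw [← Nat.cast_add, Nat.add_sub_cancel' hle]

end Conormal

/-! ### Zariski continuity and closures -/

section ZariskiTopology

variable {σ τ υ : Type}

/-- A map under which preimages of Zariski closed sets are Zariski closed. -/
def ZariskiContinuous (T : (σ → ℂ) → τ → ℂ) : Prop :=
  ∀ f : MvPolynomial τ ℂ, ∃ g : MvPolynomial σ ℂ, ∀ x, aeval x g = 0 ↔ aeval (T x) f = 0

theorem ZariskiContinuous.comp {T : (τ → ℂ) → υ → ℂ} {S : (σ → ℂ) → τ → ℂ}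
    (hT : ZariskiContinuous T) (hS : ZariskiContinuous S) : ZariskiContinuous (T ∘ S) := by
  intro f
  obtain ⟨g, hg⟩ := hT f
  obtain ⟨h, hh⟩ := hS g
  exact ⟨h, fun x => (hh x).trans (hg _)⟩

theorem zariskiContinuous_of_polynomial {T : (σ → ℂ) → τ → ℂ} (g : τ → MvPolynomial σ ℂ)
    (h : ∀ x j, T x j = aeval x (g j)) : ZariskiContinuous T := by
  intro f
  refine ⟨aeval g f, fun x => ?_⟩
  have : (aeval x : MvPolynomial σ ℂ →ₐ[ℂ] ℂ).comp (aeval g) = aeval (T x) := by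
    ext j
    simp [h]
  rw [← this]
  rfl

theorem aeval_star_map (x : σ → ℂ) (f : MvPolynomial σ ℂ) :
    aeval (star x) (map (starRingEnd ℂ) f) = star (aeval x f) := by
  induction f using MvPolynomial.induction_on with
  | C a => simp
  | add p q hp hq => rw [map_add, map_add, map_add, star_add, hp, hq]
  | mul_X p i hp => rw [map_mul, map_mul, map_mul, star_mul', hp, map_X, aeval_X, aeval_X]; rfl

theorem aeval_map_star (x : σ → ℂ) (f : MvPolynomial σ ℂ) :
    aeval x (map (starRingEnd ℂ) f) = star (aeval (star x) f) := by
  rw [← aeval_star_map, star_star]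

/-- Conjugation is not polynomial, but it pulls the hypersurface of f back to that of f with
conjugated coefficients. This is why `ZariskiContinuous` compares only zero sets. -/
theorem zariskiContinuous_star : ZariskiContinuous (star : (σ → ℂ) → σ → ℂ) := by
  intro f
  refine ⟨map (starRingEnd ℂ) f, fun x => ?_⟩
  rw [aeval_map_star, star_eq_zero]

/-- The Zariski closure of a set of points of any affine space. -/
def zcl (S : Set (σ → ℂ)) : Set (σ → ℂ) := zeroLocus ℂ (vanishingIdeal ℂ S)

theorem subset_zcl (S : Set (σ → ℂ)) : S ⊆ zcl S := zeroLocus_vanishingIdeal_le S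

theorem vanishingIdeal_zcl (S : Set (σ → ℂ)) : vanishingIdeal ℂ (zcl S) = vanishingIdeal ℂ S :=
  le_antisymm (vanishingIdeal_anti_mono (subset_zcl S)) fun _ hf _ hx => hx _ hf

theorem ZariskiContinuous.mapsTo_zcl {T : (σ → ℂ) → τ → ℂ} (hT : ZariskiContinuous T)
    {S : Set (σ → ℂ)} {S' : Set (τ → ℂ)} (h : Set.MapsTo T S (zcl S')) :
    Set.MapsTo T (zcl S) (zcl S') := by
  intro x hx f hf
  obtain ⟨g, hg⟩ := hT f
  exact (hg x).1 (hx g fun y hy => (hg y).2 (h hy f hf))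

end ZariskiTopology

/-! ### Equality of irreducible varieties by dimension -/

section Dimension

/-- The constant term of an algebraic relation for `y`, after cancelling powers of `y`, is a nonzero
multiple of `y`. -/
theorem exists_dvd_aeval_of_isAlgebraic {ι A : Type} [CommRing A] [IsDomain A] [Algebra ℂ A]
    (a : ι → A) [Algebra.IsAlgebraic (Algebra.adjoin ℂ (Set.range a)) A] {y : A} (hy : y ≠ 0) :
    ∃ p : MvPolynomial ι ℂ, p ≠ 0 ∧ y ∣ aeval a p := by
  obtain ⟨⟨u, hu⟩, hu0, hdvd⟩ := (Algebra.IsAlgebraic.isAlgebraic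
    (R := Algebra.adjoin ℂ (Set.range a)) y).exists_nonzero_dvd (mem_nonZeroDivisors_of_ne_zero hy)
  change y ∣ u at hdvd
  have hu' := hu
  rw [Algebra.adjoin_range_eq_range_aeval] at hu'
  obtain ⟨p, rfl⟩ := hu'
  refine ⟨p, fun hp => hu0 ?_, hdvd⟩
  ext
  simp [hp]

/-- A transcendence basis of B lifts to one of A, by the bound on degrees. A nonzero kernel element
would divide a nonzero polynomial in the lifts, and that polynomial would become a relation in B. -/
theorem injective_of_surjective_of_trdeg_le {A B : Type} [CommRing A] [CommRing B] [IsDomain A]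
    [IsDomain B] [Algebra ℂ A] [Algebra ℂ B] (f : A →ₐ[ℂ] B) (hf : Function.Surjective f)
    (hfin : Algebra.trdeg ℂ A < Cardinal.aleph0) (h : Algebra.trdeg ℂ A ≤ Algebra.trdeg ℂ B) :
    Function.Injective f := by
  obtain ⟨S, hS⟩ := exists_isTranscendenceBasis ℂ B
  choose a ha using fun s : S => hf s
  have hab : f ∘ a = Subtype.val := funext ha
  have hind : AlgebraicIndependent ℂ a := .of_comp f (by rw [hab]; exact hS.1)
  have hb : IsTranscendenceBasis ℂ a := hind.isTranscendenceBasis_of_trdeg_le hfin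
    (by rw [hS.cardinalMk_eq_trdeg]; exact h)
  have := hb.isAlgebraic
  rw [injective_iff_map_eq_zero]
  intro y hy
  by_contra hy0
  obtain ⟨p, hp, w, hw⟩ := exists_dvd_aeval_of_isAlgebraic a hy0
  have h1 : aeval (f ∘ a) p = f (aeval a p) := by
    rw [Function.comp_def, ← comp_aeval_apply]
  rw [hw, map_mul, hy, zero_mul, hab] at h1
  exact hp (hS.1 (by rw [h1, map_zero]))

end Dimension

/-! ### Biduality of conormal varieties of cones -/

section Biduality

variable {n : ℕ} {X : Set (Fin n → ℂ)}

/-- The matrix of the normal vector on top of the Jacobian matrix. -/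
def conormalMatrix (X : Set (Fin n → ℂ)) :
    Matrix (Option (idealOf X)) (Fin n) (MvPolynomial (Fin n ⊕ Fin n) ℂ) :=
  addRow (fun j => MvPolynomial.X (Sum.inr j)) (jacAt X fun j => MvPolynomial.X (Sum.inl j))

theorem aeval_det_conormalMatrix {A : Type*} [CommRing A] [Algebra ℂ A] (x s : Fin n → A) {k : ℕ}
    (r : Fin k → Option (idealOf X)) (c : Fin k → Fin n) :
    aeval (Sum.elim x s) ((conormalMatrix X).submatrix r c).det =
      ((addRow s (jacAt X x)).submatrix r c).det := by
  rw [AlgHom.map_det]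
  congr 1
  ext a b
  simp only [conormalMatrix, AlgHom.mapMatrix_apply, Matrix.map_apply, Matrix.submatrix_apply]
  rcases r a with - | f
  · simp [addRow]
  · simp only [addRow, Matrix.of_apply, Option.elim_some, jacAt_apply]
    rw [← AlgHom.comp_apply]
    congr 1
    ext j
    simp

theorem det_conormalMatrix_mem [hp : (idealOf X).IsPrime]
    (r : Fin (codim X + 1) → Option (idealOf X)) (c : Fin (codim X + 1) → Fin n) :
    ((conormalMatrix X).submatrix r c).det ∈ vanishingIdeal ℂ (regConormal X) := by
  rintro p ⟨hp1, hp2⟩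
  rw [← Sum.elim_comp_inl_inr p, aeval_det_conormalMatrix]
  exact minor_eq_zero_of_mem_span hp2 (finrank_jacAt_le X _ fun f hf => hf _ hp1.1) r c

/-- The rank conditions on the conormal matrix are among the equations of the conormal variety, so
closing up adds no new normal vectors over regular points. The field is arbitrary in order to cover
complex points and the generic point alike. -/
theorem mem_rowSpan_of_vanishing [hp : (idealOf X).IsPrime] {K : Type*} [Field K] [Algebra ℂ K]
    {x s : Fin n → K} (hxs : ∀ F ∈ vanishingIdeal ℂ (regConormal X), aeval (Sum.elim x s) F = 0)
    (hx : ∃ (r : Fin (codim X) → idealOf X) (c : Fin (codim X) → Fin n),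
      aeval x ((jacobian X).submatrix r c).det ≠ 0) : s ∈ rowSpan (jacAt X x) := by
  obtain ⟨r, c, h⟩ := hx
  rw [← det_jacAt] at h
  refine Submodule.span_mono ?_ (mem_span_of_minors_eq_zero (s := s) h fun r' c' => ?_)
  · rintro _ ⟨i, rfl⟩
    exact ⟨r i, rfl⟩
  · rw [← aeval_det_conormalMatrix]
    exact hxs _ (det_conormalMatrix_mem r' c')

theorem mem_normalSpace_of_mem_conormal [hp : (idealOf X).IsPrime] {z s : Fin n → ℂ}
    (h : Sum.elim z s ∈ conormal X) (hz : z ∈ regLocus X) : s ∈ normalSpace X z :=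
  mem_rowSpan_of_vanishing h (mem_regLocus_iff.1 hz).2

theorem aeval_elim_rename_inl {A : Type*} [CommRing A] [Algebra ℂ A] (x s : Fin n → A)
    (f : MvPolynomial (Fin n) ℂ) :
    aeval (Sum.elim x s) (rename Sum.inl f) = aeval x f := by
  rw [aeval_rename, Sum.elim_comp_inl]

theorem aeval_elim_rename_inr {A : Type*} [CommRing A] [Algebra ℂ A] (x s : Fin n → A)
    (f : MvPolynomial (Fin n) ℂ) :
    aeval (Sum.elim x s) (rename Sum.inr f) = aeval s f := by
  rw [aeval_rename, Sum.elim_comp_inr]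

theorem fst_mem_of_mem_conormal (hX : zariskiClosure X = X) {z s : Fin n → ℂ}
    (h : Sum.elim z s ∈ conormal X) : z ∈ X := by
  rw [← hX]
  intro f hf
  rw [← aeval_elim_rename_inl z s]
  refine h _ fun p hp => ?_
  rw [aeval_rename]
  exact hf _ hp.1.1

/-- The dual variety is the closure of the second projection of the conormal pairs, so its ideal is
an elimination ideal and inherits primeness. -/
theorem mem_idealOf_dualVariety_iff {g : MvPolynomial (Fin n) ℂ} :
    g ∈ idealOf (dualVariety X) ↔ rename Sum.inr g ∈ vanishingIdeal ℂ (regConormal X) := by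
  have : idealOf (dualVariety X) = _ := vanishingIdeal_zcl _
  rw [this]
  constructor
  · rintro h p ⟨hp1, hp2⟩
    rw [aeval_rename]
    exact h _ ⟨_, hp1, mem_normalSpace_iff.1 hp2⟩
  · rintro h s ⟨z, hz, hs⟩
    rw [← aeval_elim_rename_inr z s]
    exact h _ (elim_mem_regConormal hz (mem_normalSpace_iff.2 hs))

theorem dualVariety_isPrime [hp : (idealOf X).IsPrime] : (idealOf (dualVariety X)).IsPrime := by
  have : idealOf (dualVariety X) =
      (vanishingIdeal ℂ (regConormal X)).comap (rename (R := ℂ) Sum.inr) := by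
    ext g
    exact mem_idealOf_dualVariety_iff
  have h1 := vanishingIdeal_regConormal_isPrime X
  rw [this]
  exact Ideal.comap_isPrime _ _

theorem dualVariety_isIrreducibleAffineCone (hX : IsIrreducibleAffineCone X) :
    IsIrreducibleAffineCone (dualVariety X) where
  isClosed := congrArg (zeroLocus ℂ) (vanishingIdeal_zcl _)
  isPrime := by
    have := hX.isPrime
    exact dualVariety_isPrime
  smul_mem a := by
    have h : ZariskiContinuous (fun z : Fin n → ℂ => a • z) :=
      zariskiContinuous_of_polynomial (fun j => C a * MvPolynomial.X j) (by simp)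
    refine h.mapsTo_zcl ?_
    rintro s ⟨z, hz, hs⟩
    exact subset_zcl _ ⟨z, hz, fun t ht => by rw [smul_dotProduct, hs t ht, smul_zero]⟩

/-- Euler's relation without homogeneous generators: f(az) vanishes identically as a polynomial in
a, and its derivative at a = 1 is ∇f(z) ⬝ z. -/
theorem mem_tangentSpace_of_cone (hX : IsIrreducibleAffineCone X) {z : Fin n → ℂ} (hz : z ∈ X) :
    z ∈ tangentSpace X z := by
  intro f hf
  have h0 : aeval (fun i => (Polynomial.C (z i) * Polynomial.X : Polynomial ℂ)) f = 0 := by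
    refine Polynomial.funext fun a => ?_
    have h1 := hf _ (hX.smul_mem a z hz)
    have h2 : (Polynomial.aeval a).comp
        (aeval fun i => (Polynomial.C (z i) * Polynomial.X : Polynomial ℂ)) = aeval (a • z) := by
      ext i
      simp only [AlgHom.comp_apply, aeval_X, map_mul, Polynomial.aeval_C, Polynomial.aeval_X,
        Pi.smul_apply, smul_eq_mul]
      exact mul_comm _ _
    rw [Polynomial.eval_zero, ← h1, ← Polynomial.coe_aeval_eq_eval, ← h2]
    rfl
  have h2 := derivation_aeval Polynomial.derivative'
    (fun i => (Polynomial.C (z i) * Polynomial.X : Polynomial ℂ)) f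
  rw [h0, map_zero] at h2
  have h3 := congrArg (Polynomial.aeval (1 : ℂ)) h2
  rw [map_zero] at h3
  rw [h3, dotProduct, dotProduct, map_sum]
  refine Finset.sum_congr rfl fun i _ => ?_
  have h4 : (Polynomial.aeval (1 : ℂ)).comp
      (aeval fun i => (Polynomial.C (z i) * Polynomial.X : Polynomial ℂ)) = aeval z := by
    ext j
    simp
  rw [map_mul, ← AlgHom.comp_apply, h4]
  simp

theorem dotProduct_eq_zero_of_mem_conormal (hX : IsIrreducibleAffineCone X) {z s : Fin n → ℂ}
    (h : Sum.elim z s ∈ conormal X) : z ⬝ᵥ s = 0 := by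
  have h1 := h (∑ i, MvPolynomial.X (Sum.inl i) * MvPolynomial.X (Sum.inr i)) fun p hp => by
    have := mem_normalSpace_iff.1 hp.2 _ (mem_tangentSpace_of_cone hX hp.1.1)
    rw [dotProduct_comm] at this
    simpa [dotProduct] using this
  simpa [dotProduct] using h1

/-- Regular points paired with the normal vector 0 are conormal pairs, and regular points are dense
in X because a maximal minor lies outside the prime ideal. -/
theorem notMem_of_notMem_idealOf [hp : (idealOf X).IsPrime] {f : MvPolynomial (Fin n) ℂ}
    (hf : f ∉ idealOf X) : rename Sum.inl f ∉ vanishingIdeal ℂ (regConormal X) := by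
  obtain ⟨r, c, h⟩ := exists_jacobian_minor_notMem X
  intro h0
  have h1 : f * ((jacobian X).submatrix r c).det ∈ idealOf X := by
    intro z hz
    rw [map_mul]
    by_cases h2 : aeval z ((jacobian X).submatrix r c).det = 0
    · rw [h2, mul_zero]
    · have h3 := h0 _ (elim_mem_regConormal (mem_regLocus_iff.2 ⟨hz, r, c, h2⟩)
        (Submodule.zero_mem (normalSpace X z)))
      rw [aeval_elim_rename_inl] at h3
      rw [h3, zero_mul]
  exact (hp.mem_or_mem h1).elim hf h

/-- The base point of the generic point of the conormal variety is normal to the dual variety. -/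
theorem mem_rowSpan_dualVariety (hX : IsIrreducibleAffineCone X) {K : Type} [Field K] [Algebra ℂ K]
    [Algebra.EssFiniteType ℂ K] {x s : Fin n → K}
    (hxs : ∀ F, aeval (Sum.elim x s) F = 0 ↔ F ∈ vanishingIdeal ℂ (regConormal X)) :
    x ∈ rowSpan (jacAt (dualVariety X) s) := by
  have hp := hX.isPrime
  have hs : s ∈ rowSpan (jacAt X x) := by
    refine mem_rowSpan_of_vanishing (fun F hF => (hxs F).2 hF) ?_
    obtain ⟨r, c, h⟩ := exists_jacobian_minor_notMem X
    refine ⟨r, c, fun h0 => ?_⟩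
    rw [← aeval_elim_rename_inl x s, hxs] at h0
    exact notMem_of_notMem_idealOf h h0
  rw [mem_span_range_iff_dotProduct]
  intro t ht
  -- The tangent vector of the dual variety becomes a derivation of the whole field, which moves the
  -- base point `x` as well.
  obtain ⟨D, hD⟩ := exists_derivation_of_tangent s t fun f hf => ht ⟨f, by
    rwa [mem_idealOf_dualVariety_iff, ← hxs, aeval_elim_rename_inr]⟩
  have h1 : x ⬝ᵥ s = 0 := by
    have : (∑ i, MvPolynomial.X (Sum.inl i) * MvPolynomial.X (Sum.inr i) :
        MvPolynomial (Fin n ⊕ Fin n) ℂ) ∈ vanishingIdeal ℂ (regConormal X) := fun p hp => by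
      have h := dotProduct_eq_zero_of_mem_conormal hX
        (z := p ∘ Sum.inl) (s := p ∘ Sum.inr) (by
          rw [Sum.elim_comp_inl_inr]
          exact subset_zcl _ hp)
      simpa [dotProduct] using h
    simpa [dotProduct] using (hxs _).2 this
  -- D x is tangent to X at x, and s is normal there.
  have h2 : s ⬝ᵥ (fun i => D (x i)) = 0 := by
    refine (mem_span_range_iff_dotProduct _ s).1 hs _ fun f => ?_
    refine (derivation_aeval D x f.1).symm.trans ?_
    rw [← aeval_elim_rename_inl x s, (hxs _).2, map_zero]
    intro p hp
    rw [aeval_rename]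
    exact f.2 _ hp.1.1
  have h3 := congrArg D h1
  rw [dotProduct, map_sum, map_zero] at h3
  simp only [Derivation.leibniz, smul_eq_mul, Finset.sum_add_distrib, hD] at h3
  rw [dotProduct] at h2 ⊢
  rwa [h2, add_zero] at h3

theorem elim_comp_swap {α β γ : Type*} (a : α → γ) (b : β → γ) :
    Sum.elim a b ∘ Sum.swap = Sum.elim b a := by
  ext (i | i) <;> rfl

/-- Normality of the base point to the dual, known at the generic point, is a rank condition; its
minors are therefore polynomials vanishing on all conormal pairs. -/
theorem det_conormalMatrix_dualVariety (hX : IsIrreducibleAffineCone X)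
    (r : Fin (codim (dualVariety X) + 1) → Option (idealOf (dualVariety X)))
    (c : Fin (codim (dualVariety X) + 1) → Fin n) :
    rename Sum.swap ((conormalMatrix (dualVariety X)).submatrix r c).det ∈
      vanishingIdeal ℂ (regConormal X) := by
  have hp := hX.isPrime
  have hprime := vanishingIdeal_regConormal_isPrime X
  have hp' := dualVariety_isPrime (X := X)
  have := essFiniteType_fractionRing (vanishingIdeal ℂ (regConormal X))
  set q := genericPoint (vanishingIdeal ℂ (regConormal X)) with hq
  have hx := mem_rowSpan_dualVariety hX (x := q ∘ Sum.inl) (s := q ∘ Sum.inr) fun F => by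
    rw [Sum.elim_comp_inl_inr]
    exact aeval_genericPoint_eq_zero_iff _ F
  rw [← aeval_genericPoint_eq_zero_iff, aeval_rename, ← hq,
    ← Sum.elim_comp_inl_inr (q ∘ Sum.swap), aeval_det_conormalMatrix]
  refine minor_eq_zero_of_mem_span hx (finrank_jacAt_le _ _ fun f hf => ?_) r c
  rw [mem_idealOf_dualVariety_iff, ← aeval_genericPoint_eq_zero_iff, aeval_rename] at hf
  exact hf

theorem mem_normalSpace_dualVariety (hX : IsIrreducibleAffineCone X) {z s : Fin n → ℂ}
    (h : Sum.elim z s ∈ conormal X) (hs : ∃ (r : Fin (codim (dualVariety X)) → idealOf (dualVariety X))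
      (c : Fin (codim (dualVariety X)) → Fin n),
      aeval s ((jacobian (dualVariety X)).submatrix r c).det ≠ 0) :
    z ∈ normalSpace (dualVariety X) s := by
  obtain ⟨r, c, hrc⟩ := hs
  rw [← det_jacAt] at hrc
  refine Submodule.span_mono ?_ (mem_span_of_minors_eq_zero (s := z) hrc fun r' c' => ?_)
  · rintro _ ⟨i, rfl⟩
    exact ⟨r i, rfl⟩
  · have h1 := h _ (det_conormalMatrix_dualVariety hX r' c')
    rwa [aeval_rename, elim_comp_swap,
      aeval_det_conormalMatrix] at h1

theorem snd_mem_dualVariety {z s : Fin n → ℂ} (h : Sum.elim z s ∈ conormal X) :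
    s ∈ dualVariety X := by
  have h0 : zariskiClosure (dualVariety X) = dualVariety X := congrArg (zeroLocus ℂ) (vanishingIdeal_zcl _)
  rw [← h0]
  intro g hg
  rw [← aeval_elim_rename_inr z s]
  exact h _ (mem_idealOf_dualVariety_iff.1 hg)

/-- Where a maximal minor of the dual is nonzero, the swapped pair is a regular conormal pair of the
dual, so the product of the minor with the swapped `F` vanishes everywhere. The minor cancels by
primeness. -/
theorem rename_swap_mem (hX : IsIrreducibleAffineCone X) {F : MvPolynomial (Fin n ⊕ Fin n) ℂ}
    (hF : F ∈ vanishingIdeal ℂ (regConormal (dualVariety X))) :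
    rename Sum.swap F ∈ vanishingIdeal ℂ (regConormal X) := by
  have hp := hX.isPrime
  have hprime := vanishingIdeal_regConormal_isPrime X
  have hp' := dualVariety_isPrime (X := X)
  obtain ⟨r, c, h⟩ := exists_jacobian_minor_notMem (dualVariety X)
  rw [mem_idealOf_dualVariety_iff] at h
  refine (hprime.mem_or_mem (fun p hp => ?_ : rename Sum.inr _ * rename Sum.swap F ∈ _)).resolve_left h
  have hp1 : Sum.elim (p ∘ Sum.inl) (p ∘ Sum.inr) ∈ conormal X := by
    rw [Sum.elim_comp_inl_inr]
    exact subset_zcl _ hp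
  rw [map_mul, aeval_rename, aeval_rename]
  by_cases h0 : aeval (p ∘ Sum.inr) ((jacobian (dualVariety X)).submatrix r c).det = 0
  · rw [h0, zero_mul]
  · have h1 : p ∘ Sum.swap = Sum.elim (p ∘ Sum.inr) (p ∘ Sum.inl) := by
      ext (i | i) <;> rfl
    rw [h1, hF _ (elim_mem_regConormal
      (mem_regLocus_iff.2 ⟨snd_mem_dualVariety hp1, r, c, h0⟩)
      (mem_normalSpace_dualVariety hX hp1 ⟨r, c, h0⟩)), mul_zero]

/-- The one inclusion induces a surjection of coordinate rings, both domains of transcendence degree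
n, which must then be injective. -/
theorem rename_swap_mem_iff (hX : IsIrreducibleAffineCone X) {F : MvPolynomial (Fin n ⊕ Fin n) ℂ} :
    rename Sum.swap F ∈ vanishingIdeal ℂ (regConormal X) ↔
      F ∈ vanishingIdeal ℂ (regConormal (dualVariety X)) := by
  refine ⟨fun h => ?_, rename_swap_mem hX⟩
  have hp := hX.isPrime
  have hp' := dualVariety_isPrime (X := X)
  have hprime := vanishingIdeal_regConormal_isPrime X
  have hprime' := vanishingIdeal_regConormal_isPrime (dualVariety X)
  let f := Ideal.quotientMapₐ (vanishingIdeal ℂ (regConormal X))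
    (rename (R := ℂ) (Sum.swap : Fin n ⊕ Fin n → Fin n ⊕ Fin n)) fun F hF => rename_swap_mem hX hF
  have hf : Function.Surjective f := by
    intro y
    obtain ⟨G, rfl⟩ := Ideal.Quotient.mk_surjective y
    refine ⟨Ideal.Quotient.mk _ (rename Sum.swap G), ?_⟩
    change Ideal.Quotient.mk _ (rename Sum.swap (rename Sum.swap G)) = _
    rw [rename_rename, Sum.swap_swap_eq, rename_id_apply]
  have hinj := injective_of_surjective_of_trdeg_le f hf
    (by rw [trdeg_conormal]; exact Cardinal.natCast_lt_aleph0)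
    (by rw [trdeg_conormal, trdeg_conormal])
  rw [← Ideal.Quotient.eq_zero_iff_mem]
  apply hinj
  rw [map_zero]
  exact Ideal.Quotient.eq_zero_iff_mem.2 h

/-- Biduality of conormal varieties. -/
theorem mem_conormal_dualVariety_iff (hX : IsIrreducibleAffineCone X) {z s : Fin n → ℂ} :
    Sum.elim s z ∈ conormal (dualVariety X) ↔ Sum.elim z s ∈ conormal X := by
  constructor
  · intro h F hF
    have h1 := h (rename Sum.swap F) (by
      rwa [← rename_swap_mem_iff hX, rename_rename, Sum.swap_swap_eq, rename_id_apply])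
    rwa [aeval_rename, elim_comp_swap] at h1
  · intro h F hF
    have h1 := h _ (rename_swap_mem hX hF)
    rwa [aeval_rename, elim_comp_swap] at h1

end Biduality

/-! ### Zero loci of saturations, sums and products of ideals -/

section Saturation

theorem pow_mem_saturation {R : Type*} [CommRing R] {I J : Ideal R} {f : R} {N : ℕ}
    (h : (Ideal.span {f} * J) ^ N ≤ I) : f ^ N ∈ saturation I J := by
  refine (le_iSup (fun k : ℕ => Submodule.colon I ((J ^ k : Ideal R) : Set R)) N)
    (Submodule.mem_colon.2 fun g hg => h ?_)
  rw [mul_pow, Ideal.span_singleton_pow]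
  exact Ideal.mul_mem_mul (Ideal.mem_span_singleton_self _) hg

theorem saturation_le {R : Type*} [CommRing R] {I J P : Ideal R}
    (h : ∀ (k : ℕ) (f : R), (∀ g ∈ J ^ k, f * g ∈ I) → f ∈ P) : saturation I J ≤ P :=
  iSup_le fun k f hf => h k f (Submodule.mem_colon.1 hf)

/-- The zero locus of a saturation is the closure of a difference of zero loci. -/
theorem zeroLocus_saturation {σ : Type} [Finite σ] (I J : Ideal (MvPolynomial σ ℂ)) :
    zeroLocus ℂ (saturation I J) = zcl (zeroLocus ℂ I \ zeroLocus ℂ J) := by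
  apply Set.Subset.antisymm
  · intro x hx f hf
    -- Nullstellensatz: f·J vanishes on the zero locus of I. By finite generation a power (f·J)^N
    -- lies in I, which puts f^N in the saturation.
    have hle : Ideal.span {f} * J ≤ I.radical := by
      rw [Ideal.span_singleton_mul_le_iff]
      intro g hg
      rw [← vanishingIdeal_zeroLocus_eq_radical (K := ℂ)]
      intro y hy
      by_cases hyJ : y ∈ zeroLocus ℂ J
      · rw [map_mul, hyJ g hg, mul_zero]
      · rw [map_mul, hf y ⟨hy, hyJ⟩, zero_mul]
    obtain ⟨N, hN⟩ := Ideal.exists_pow_le_of_le_radical_of_fg hle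
      (IsNoetherian.noetherian _)
    have h2 := hx _ (pow_mem_saturation hN)
    rw [map_pow] at h2
    exact eq_zero_of_pow_eq_zero h2
  · have hle : saturation I J ≤ vanishingIdeal ℂ (zeroLocus ℂ I \ zeroLocus ℂ J) := by
      refine saturation_le fun k f hf y hy => ?_
      obtain ⟨hyI, hyJ⟩ := hy
      rw [mem_zeroLocus_iff] at hyJ
      push Not at hyJ
      obtain ⟨g, hg, hgy⟩ := hyJ
      have h1 := hyI _ (hf _ (Ideal.pow_mem_pow hg k))
      rw [map_mul, map_pow] at h1
      exact (mul_eq_zero.1 h1).resolve_right (pow_ne_zero k hgy)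
    exact zeroLocus_anti_mono hle

theorem mem_zeroLocus_sup {σ : Type} {I J : Ideal (MvPolynomial σ ℂ)} {x : σ → ℂ} :
    x ∈ zeroLocus ℂ (I ⊔ J) ↔ x ∈ zeroLocus ℂ I ∧ x ∈ zeroLocus ℂ J := by
  constructor
  · intro h
    exact ⟨zeroLocus_anti_mono le_sup_left h, zeroLocus_anti_mono le_sup_right h⟩
  · rintro ⟨h1, h2⟩
    have : I ⊔ J ≤ RingHom.ker (aeval x : MvPolynomial σ ℂ →ₐ[ℂ] ℂ) :=
      sup_le (fun f hf => h1 f hf) fun f hf => h2 f hf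
    exact fun f hf => this hf

theorem mem_zeroLocus_mul {σ : Type} {I J : Ideal (MvPolynomial σ ℂ)} {x : σ → ℂ} :
    x ∈ zeroLocus ℂ (I * J) ↔ x ∈ zeroLocus ℂ I ∨ x ∈ zeroLocus ℂ J := by
  constructor
  · intro h
    by_contra! hx
    obtain ⟨h1, h2⟩ := hx
    rw [mem_zeroLocus_iff] at h1 h2
    push Not at h1 h2
    obtain ⟨f, hf, hfx⟩ := h1
    obtain ⟨g, hg, hgx⟩ := h2
    have := h _ (Ideal.mul_mem_mul hf hg)
    rw [map_mul] at this
    exact (mul_ne_zero hfx hgx) this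
  · rintro (h | h)
    · exact zeroLocus_anti_mono Ideal.mul_le_left h
    · exact zeroLocus_anti_mono Ideal.mul_le_right h

theorem mem_zeroLocus_map {σ τ : Type} {φ : MvPolynomial σ ℂ →+* MvPolynomial τ ℂ}
    {I : Ideal (MvPolynomial σ ℂ)} {x : τ → ℂ} :
    x ∈ zeroLocus ℂ (I.map φ) ↔ ∀ f ∈ I, aeval x (φ f) = 0 := by
  rw [Ideal.map, zeroLocus_span]
  simp

end Saturation

/-! ### Solutions of the critical ideal as pairs of conormal points -/

section Solutions

variable {n : ℕ} {X : Set (Fin n → ℂ)}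

/-- The point `(w̄, z̄, v̄, ū)`. -/
def starPoint (q : Fin 4 × Fin n → ℂ) : Fin 4 × Fin n → ℂ :=
  fun a => star (q ((![1, 0, 3, 2] : Fin 4 → Fin 4) a.1, a.2))

theorem aeval_inclZ (q : Fin 4 × Fin n → ℂ) (f : MvPolynomial (Fin n) ℂ) :
    aeval q (inclZ n f) = aeval (fun i => q (0, i)) f :=
  aeval_rename ..

theorem aeval_starMap (q : Fin 4 × Fin n → ℂ) (F : Ring4 n) :
    aeval q (starMap n F) = star (aeval (starPoint q) F) := by
  change aeval q (rename _ (map (starRingEnd ℂ) F)) = _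
  rw [aeval_rename, aeval_map_star]
  rfl

theorem mem_zeroLocus_map_starMap {I : Ideal (Ring4 n)} {q : Fin 4 × Fin n → ℂ} :
    q ∈ zeroLocus ℂ (I.map (starMap n)) ↔ starPoint q ∈ zeroLocus ℂ I := by
  rw [mem_zeroLocus_map]
  simp_rw [aeval_starMap, star_eq_zero]
  rfl

/-- The point `(z, v - w)`. -/
def conormalPoint (q : Fin 4 × Fin n → ℂ) : Fin n ⊕ Fin n → ℂ :=
  Sum.elim (fun i => q (0, i)) fun i => q (3, i) - q (1, i)

theorem aeval_augmentedJacobian_minor (q : Fin 4 × Fin n → ℂ) {k : ℕ}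
    (r : Fin k → Option (idealOf X)) (c : Fin k → Fin n) :
    aeval q ((augmentedJacobian X).submatrix r c).det =
      ((addRow (conormalPoint q ∘ Sum.inr) (jacAt X (conormalPoint q ∘ Sum.inl))).submatrix
        r c).det := by
  rw [AlgHom.map_det]
  congr 1
  ext a b
  simp only [AlgHom.mapMatrix_apply, Matrix.map_apply, Matrix.submatrix_apply]
  rcases r a with - | f
  · simp [addRow, augmentedJacobian, conormalPoint]
  · exact aeval_inclZ q _

theorem mem_zeroLocus_augIdeal {q : Fin 4 × Fin n → ℂ} :
    q ∈ zeroLocus ℂ (augIdeal X) ↔ ∀ (r : Fin (codim X + 1) → Option (idealOf X))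
      (c : Fin (codim X + 1) → Fin n), ((addRow (conormalPoint q ∘ Sum.inr)
        (jacAt X (conormalPoint q ∘ Sum.inl))).submatrix r c).det = 0 := by
  rw [augIdeal, zeroLocus_span]
  simp_rw [← aeval_augmentedJacobian_minor]
  constructor
  · intro h r c
    exact h _ ⟨r, c, rfl⟩
  · rintro h _ ⟨r, c, rfl⟩
    exact h r c

theorem conormalPoint_mem_regConormal_iff (hX : zariskiClosure X = X) [hp : (idealOf X).IsPrime]
    {q : Fin 4 × Fin n → ℂ} : conormalPoint q ∈ regConormal X ↔
      (q ∈ zeroLocus ℂ ((idealOf X).map (inclZ n)) ∧ q ∈ zeroLocus ℂ (augIdeal X)) ∧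
        q ∉ zeroLocus ℂ ((singIdeal X).map (inclZ n)) := by
  have h0 : q ∈ zeroLocus ℂ ((idealOf X).map (inclZ n)) ↔ conormalPoint q ∘ Sum.inl ∈ X := by
    rw [mem_zeroLocus_map]
    simp_rw [aeval_inclZ]
    exact Set.ext_iff.1 hX (conormalPoint q ∘ Sum.inl)
  have h1 : q ∈ zeroLocus ℂ ((singIdeal X).map (inclZ n)) ↔
      conormalPoint q ∘ Sum.inl ∈ zeroLocus ℂ (singIdeal X) := by
    rw [mem_zeroLocus_map]
    simp_rw [aeval_inclZ]
    rfl
  rw [h0, h1, mem_zeroLocus_augIdeal]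
  constructor
  · rintro ⟨hz, hs⟩
    exact ⟨⟨hz.1, minor_eq_zero_of_mem_span hs (finrank_jacAt_le X _ fun f hf => hf _ hz.1)⟩, hz.2⟩
  · rintro ⟨⟨hz, hm⟩, hz'⟩
    refine ⟨⟨hz, hz'⟩, ?_⟩
    obtain ⟨r, c, h⟩ := (mem_regLocus_iff.1 ⟨hz, hz'⟩).2
    rw [← det_jacAt] at h
    refine Submodule.span_mono ?_ (mem_span_of_minors_eq_zero h hm)
    rintro _ ⟨i, rfl⟩
    exact ⟨r i, rfl⟩

/-- The points over which the critical ideal is the closure. -/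
def regCritical (X : Set (Fin n → ℂ)) : Set (Fin 4 × Fin n → ℂ) :=
  {q | conormalPoint q ∈ regConormal X ∧ conormalPoint (starPoint q) ∈ regConormal X}

/-- A starred ideal vanishes at q exactly when the unstarred one vanishes at `starPoint q`, so the
conditions split into the same conormal condition at q and at `starPoint q`. -/
theorem zeroLocus_criticalIdeal (hX : zariskiClosure X = X) [hp : (idealOf X).IsPrime] :
    zeroLocus ℂ (criticalIdeal X) = zcl (regCritical X) := by
  rw [criticalIdeal, zeroLocus_saturation]
  congr 1
  ext q
  rw [regCritical, Set.mem_ofPred_eq, conormalPoint_mem_regConormal_iff hX,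
    conormalPoint_mem_regConormal_iff hX, Set.mem_sdiff, mem_zeroLocus_sup, mem_zeroLocus_sup,
    mem_zeroLocus_sup, mem_zeroLocus_mul, mem_zeroLocus_map_starMap, mem_zeroLocus_map_starMap,
    mem_zeroLocus_map_starMap]
  tauto

/-- The point `(z, w, u, v)` with `(z, v - w) = p` and `(w̄, ū - z̄) = p'`. -/
def joinPoint (p p' : Fin n ⊕ Fin n → ℂ) (a : Fin 4 × Fin n) : ℂ :=
  (![p (Sum.inl a.2), star (p' (Sum.inl a.2)), p (Sum.inl a.2) + star (p' (Sum.inr a.2)),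
    p (Sum.inr a.2) + star (p' (Sum.inl a.2))] : Fin 4 → ℂ) a.1

theorem conormalPoint_joinPoint (p p' : Fin n ⊕ Fin n → ℂ) :
    conormalPoint (joinPoint p p') = p := by
  ext (i | i) <;> simp [conormalPoint, joinPoint]

theorem conormalPoint_starPoint_joinPoint (p p' : Fin n ⊕ Fin n → ℂ) :
    conormalPoint (starPoint (joinPoint p p')) = p' := by
  ext (i | i) <;> simp [conormalPoint, joinPoint, starPoint]

theorem joinPoint_conormalPoint (q : Fin 4 × Fin n → ℂ) :
    joinPoint (conormalPoint q) (conormalPoint (starPoint q)) = q := by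
  ext ⟨k, i⟩
  fin_cases k <;> simp [conormalPoint, joinPoint, starPoint]

theorem regCritical_eq_image2 :
    regCritical X = Set.image2 joinPoint (regConormal X) (regConormal X) := by
  ext q
  constructor
  · rintro ⟨h1, h2⟩
    exact ⟨_, h1, _, h2, joinPoint_conormalPoint q⟩
  · rintro ⟨p, h1, p', h2, rfl⟩
    rw [regCritical, Set.mem_ofPred_eq, conormalPoint_joinPoint, conormalPoint_starPoint_joinPoint]
    exact ⟨h1, h2⟩

theorem zariskiContinuous_conormalPoint :
    ZariskiContinuous (conormalPoint : (Fin 4 × Fin n → ℂ) → _) :=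
  zariskiContinuous_of_polynomial
    (Sum.elim (fun i => MvPolynomial.X (0, i))
      fun i => MvPolynomial.X (3, i) - MvPolynomial.X (1, i))
    (by rintro x (i | i) <;> simp [conormalPoint])

theorem zariskiContinuous_comp_index {σ τ : Type} (e : τ → σ) :
    ZariskiContinuous fun x : σ → ℂ => x ∘ e :=
  zariskiContinuous_of_polynomial (fun j => MvPolynomial.X (e j)) fun x j => (aeval_X x (e j)).symm

theorem zariskiContinuous_starPoint :
    ZariskiContinuous (starPoint : (Fin 4 × Fin n → ℂ) → _) := by
  have h := zariskiContinuous_star.comp (zariskiContinuous_comp_index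
    fun a : Fin 4 × Fin n => ((![1, 0, 3, 2] : Fin 4 → Fin 4) a.1, a.2))
  exact h

theorem zariskiContinuous_joinPoint_left (p' : Fin n ⊕ Fin n → ℂ) :
    ZariskiContinuous fun p => joinPoint p p' :=
  zariskiContinuous_of_polynomial (fun a => (![MvPolynomial.X (Sum.inl a.2),
    C (star (p' (Sum.inl a.2))), MvPolynomial.X (Sum.inl a.2) + C (star (p' (Sum.inr a.2))),
    MvPolynomial.X (Sum.inr a.2) + C (star (p' (Sum.inl a.2)))] : Fin 4 → _) a.1) (by
      rintro p ⟨k, i⟩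
      fin_cases k <;> simp [joinPoint])

theorem zariskiContinuous_joinPoint_right (p : Fin n ⊕ Fin n → ℂ) :
    ZariskiContinuous fun p' => joinPoint p p' := by
  -- The second argument enters only through its conjugate: the map is polynomial after a
  -- conjugation.
  have h : ZariskiContinuous fun p' => joinPoint p (star p') :=
    zariskiContinuous_of_polynomial (fun a => (![C (p (Sum.inl a.2)),
      MvPolynomial.X (Sum.inl a.2), C (p (Sum.inl a.2)) + MvPolynomial.X (Sum.inr a.2),
      C (p (Sum.inr a.2)) + MvPolynomial.X (Sum.inl a.2)] : Fin 4 → _) a.1) (by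
        rintro p ⟨k, i⟩
        fin_cases k <;> simp [joinPoint])
  have h2 := h.comp zariskiContinuous_star
  simpa [Function.comp_def] using h2

/-- The closure of a product is the product of the closures: `joinPoint` is Zariski continuous in
each argument, so the arguments can be closed up one at a time. -/
theorem mem_zcl_regCritical_iff {q : Fin 4 × Fin n → ℂ} : q ∈ zcl (regCritical X) ↔
    conormalPoint q ∈ conormal X ∧ conormalPoint (starPoint q) ∈ conormal X := by
  constructor
  · intro h
    exact ⟨zariskiContinuous_conormalPoint.mapsTo_zcl (fun q hq => subset_zcl _ hq.1) h,
      (zariskiContinuous_conormalPoint.comp zariskiContinuous_starPoint).mapsTo_zcl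
        (fun q hq => subset_zcl _ hq.2) h⟩
  · rintro ⟨h1, h2⟩
    rw [← joinPoint_conormalPoint q]
    refine (zariskiContinuous_joinPoint_left _).mapsTo_zcl (fun p hp => ?_) h1
    refine (zariskiContinuous_joinPoint_right p).mapsTo_zcl (fun p' hp' => ?_) h2
    refine subset_zcl _ ?_
    rw [regCritical_eq_image2]
    exact ⟨p, hp, p', hp', rfl⟩

/-- The solutions of the Hermitian critical ideal in terms of the conormal variety. -/
theorem mem_solutions_iff (hX : IsIrreducibleAffineCone X) {u v : Fin n → ℂ}
    {p : (Fin n → ℂ) × (Fin n → ℂ)} : p ∈ solutions X u v ↔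
      Sum.elim p.1 (v - p.2) ∈ conormal X ∧
        Sum.elim (star p.2) (star u - star p.1) ∈ conormal X := by
  have := hX.isPrime
  change _ ∈ zeroLocus ℂ (criticalIdeal X) ↔ _
  rw [zeroLocus_criticalIdeal hX.isClosed, mem_zcl_regCritical_iff]
  refine Iff.of_eq (congrArg₂ (fun a b => a ∈ conormal X ∧ b ∈ conormal X) ?_ ?_)
  · ext (i | i) <;> simp [conormalPoint]
  · ext (i | i) <;> simp [conormalPoint, starPoint]

end Solutions

/-! ### Counting extensions of a generic homomorphism to ℂ -/

section GenericFibre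

open scoped IntermediateField

variable {B A : Type} [CommRing B] [IsDomain B] [CommRing A] [IsDomain A] [Algebra B A]
  [FaithfulSMul B A]

theorem exists_map_eq_C_mul {B : Type} [CommRing B] [IsDomain B]
    (p : Polynomial (FractionRing B)) : ∃ d : B, d ≠ 0 ∧ ∃ q : Polynomial B,
      q.map (algebraMap B (FractionRing B)) = Polynomial.C (algebraMap B _ d) * p := by
  obtain ⟨d, hd, h⟩ := IsLocalization.integerNormalization_spec (nonZeroDivisors B) p
  refine ⟨d, nonZeroDivisors.ne_zero hd, _, h.trans ?_⟩
  rw [← Polynomial.smul_eq_C_mul, algebraMap_smul]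

/-- A primitive element of the fraction fields, scaled into `A` and made integral. The element δ
plays the role of a discriminant: where it is nonzero, the specialized minimal polynomial has simple
roots. -/
theorem exists_integral_primitive_element [IsIntegrallyClosed B] [CharZero B]
    [Algebra.IsAlgebraic B A] [Algebra.FiniteType B A] :
    ∃ α : A, IsIntegral B α ∧
      (∀ a : A, ∃ d : B, d ≠ 0 ∧ ∃ R : Polynomial B, d • a = Polynomial.aeval α R) ∧
      ∃ δ : B, δ ≠ 0 ∧ ∃ u v : Polynomial B,
        u * minpoly B α + v * Polynomial.derivative (minpoly B α) = Polynomial.C δ := by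
  let K := FractionRing B
  let L := FractionRing A
  let _ : Algebra K L := FractionRing.liftAlgebra B L
  have : IsScalarTower B K L := FractionRing.isScalarTower_liftAlgebra B L
  have : CharZero K := charZero_of_injective_algebraMap (IsFractionRing.injective B K)
  have hAL : Algebra.IsAlgebraic A L := IsLocalization.isAlgebraic (S := L) (nonZeroDivisors A)
  have hBL : Algebra.IsAlgebraic B L := Algebra.IsAlgebraic.trans B A L
  have hKL : Algebra.IsAlgebraic K L := IsFractionRing.comap_isAlgebraic_iff.1 hBL
  have : Algebra.EssFiniteType A L := .of_isLocalization _ (nonZeroDivisors A)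
  have : Algebra.EssFiniteType B L := .comp B A L
  have : Algebra.EssFiniteType K L := .of_comp B K L
  have hfin : FiniteDimensional K L :=
    Algebra.finite_of_essFiniteType_of_isAlgebraic
  obtain ⟨θ, hθ⟩ := Field.exists_primitive_element K L
  obtain ⟨b, hb, hbθ⟩ := (hBL.isAlgebraic θ).exists_integral_multiple
  obtain ⟨α₀, β₀, hαβ⟩ := IsFractionRing.div_surjective (A := A) (b • θ)
  obtain ⟨hβ, hαβ⟩ := hαβ
  obtain ⟨e, he, w, hw⟩ := (Algebra.IsAlgebraic.isAlgebraic (R := B) β₀).exists_nonzero_dvd hβ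
  -- Here b • θ = α₀ / β₀ is integral, and e = β₀ w is a multiple of the denominator lying in B; so
  -- e clears the denominator and keeps integrality.
  have hα : algebraMap A L (α₀ * w) = (e * b) • θ := by
    have hβ0 : algebraMap A L β₀ ≠ 0 := by
      rw [Ne, FaithfulSMul.algebraMap_eq_zero_iff]
      exact nonZeroDivisors.ne_zero hβ
    rw [mul_smul, ← hαβ, Algebra.smul_def, IsScalarTower.algebraMap_apply B A L, hw, map_mul,
      map_mul, mul_right_comm, mul_div_cancel₀ _ hβ0]
  set α := α₀ * w
  have hc : (e * b : B) ≠ 0 := mul_ne_zero he hb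
  have hint : IsIntegral B α := by
    rw [← isIntegral_algebraMap_iff (IsFractionRing.injective A L), hα, mul_smul]
    exact hbθ.smul e
  have htop : K⟮algebraMap A L α⟯ = ⊤ := by
    rw [eq_top_iff, ← hθ, IntermediateField.adjoin_simple_le_iff]
    have h1 : θ = (algebraMap B K (e * b))⁻¹ • algebraMap A L α := by
      rw [hα, ← algebraMap_smul K (e * b) θ, smul_smul, inv_mul_cancel₀, one_smul]
      rwa [Ne, FaithfulSMul.algebraMap_eq_zero_iff]
    rw [h1]
    exact IntermediateField.smul_mem _ (IntermediateField.mem_adjoin_simple_self K _)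
  have hmin : minpoly K (algebraMap A L α) = (minpoly B α).map (algebraMap B K) :=
    minpoly.isIntegrallyClosed_eq_field_fractions K L hint
  refine ⟨α, hint, fun a => ?_, ?_⟩
  · have h1 : algebraMap A L a ∈ K⟮algebraMap A L α⟯ := by
      rw [htop]
      trivial
    rw [← IntermediateField.mem_toSubalgebra,
      IntermediateField.adjoin_simple_toSubalgebra_of_isAlgebraic (hKL.isAlgebraic _),
      Algebra.adjoin_singleton_eq_range_aeval] at h1
    obtain ⟨p, hp⟩ := h1
    obtain ⟨d, hd, q, hq⟩ := exists_map_eq_C_mul p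
    refine ⟨d, hd, q, IsFractionRing.injective A L ?_⟩
    rw [← Polynomial.aeval_algebraMap_apply, ← Polynomial.aeval_map_algebraMap K, hq, map_mul,
      Polynomial.aeval_C, Algebra.smul_def, map_mul, ← IsScalarTower.algebraMap_apply,
      ← IsScalarTower.algebraMap_apply]
    congr 1
    exact hp.symm
  · have hsep : (minpoly K (algebraMap A L α)).Separable :=
      (minpoly.irreducible (hKL.isAlgebraic _).isIntegral).separable
    obtain ⟨p, q, hpq⟩ := hsep
    obtain ⟨d, hd, p', hp'⟩ := exists_map_eq_C_mul p
    obtain ⟨f, hf, q', hq'⟩ := exists_map_eq_C_mul q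
    refine ⟨d * f, mul_ne_zero hd hf, Polynomial.C f * p', Polynomial.C d * q', ?_⟩
    apply Polynomial.map_injective _ (IsFractionRing.injective B K)
    rw [hmin, Polynomial.derivative_map] at hpq
    change Polynomial.map (algebraMap B K) p' = Polynomial.C (algebraMap B K d) * p at hp'
    change Polynomial.map (algebraMap B K) q' = Polynomial.C (algebraMap B K f) * q at hq'
    simp only [Polynomial.map_add, Polynomial.map_mul, Polynomial.map_C, hp', hq', map_mul]
    linear_combination Polynomial.C (algebraMap B K d) * Polynomial.C (algebraMap B K f) * hpq

omit [IsDomain A] [FaithfulSMul B A] in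
-- The product of the denominators of finitely many algebra generators serves all elements, once
-- powers of it are allowed.
theorem exists_common_denominator [Algebra.FiniteType B A] {α : A}
    (h : ∀ a : A, ∃ d : B, d ≠ 0 ∧ ∃ R : Polynomial B, d • a = Polynomial.aeval α R) :
    ∃ d : B, d ≠ 0 ∧ ∀ a : A, ∃ (N : ℕ) (R : Polynomial B),
      d ^ N • a = Polynomial.aeval α R := by
  obtain ⟨S, hS⟩ := (inferInstance : Algebra.FiniteType B A).out
  choose d hd R hR using h
  refine ⟨∏ s ∈ S, d s, Finset.prod_ne_zero_iff.2 fun s _ => hd s, fun a => ?_⟩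
  have ha : a ∈ Algebra.adjoin B (S : Set A) := by rw [hS]; trivial
  induction ha using Algebra.adjoin_induction with
  | mem s hs =>
    obtain ⟨w, hw⟩ := Finset.dvd_prod_of_mem d hs
    refine ⟨1, Polynomial.C w * R s, ?_⟩
    rw [pow_one, hw, map_mul, ← hR, Polynomial.aeval_C, mul_comm, mul_smul, Algebra.smul_def]
  | algebraMap r => exact ⟨0, Polynomial.C r, by simp⟩
  | add x y _ _ hx hy =>
    obtain ⟨N, P, hP⟩ := hx
    obtain ⟨M, Q, hQ⟩ := hy
    refine ⟨N + M, Polynomial.C ((∏ s ∈ S, d s) ^ M) * P +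
      Polynomial.C ((∏ s ∈ S, d s) ^ N) * Q, ?_⟩
    rw [map_add, map_mul, map_mul, ← hP, ← hQ, Polynomial.aeval_C, Polynomial.aeval_C]
    simp only [Algebra.smul_def, map_pow]
    ring
  | mul x y _ _ hx hy =>
    obtain ⟨N, P, hP⟩ := hx
    obtain ⟨M, Q, hQ⟩ := hy
    refine ⟨N + M, P * Q, ?_⟩
    rw [map_mul, ← hP, ← hQ]
    simp only [Algebra.smul_def, map_pow]
    ring

/-- Ring homomorphisms to a field extend along a primitive element. -/
theorem exists_ringHom_of_root [IsIntegrallyClosed B] {F : Type} [Field F] {α : A}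
    (hα : IsIntegral B α) {d : B}
    (hd : ∀ a : A, ∃ (N : ℕ) (R : Polynomial B), d ^ N • a = Polynomial.aeval α R)
    (y : B →+* F) (hy : y d ≠ 0) (ρ : F) (hρ : (minpoly B α).eval₂ y ρ = 0) :
    ∃ ψ : A →+* F, ψ.comp (algebraMap B A) = y ∧ ψ α = ρ := by
  -- Over an integrally closed base the minimal polynomial divides every relation of α. Hence the
  -- fraction defining `ψ` does not depend on the chosen representation, which is the content of
  -- `key`.
  have hzero (R : Polynomial B) (hR : Polynomial.aeval α R = 0) : R.eval₂ y ρ = 0 := by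
    obtain ⟨w, rfl⟩ := minpoly.isIntegrallyClosed_dvd hα hR
    rw [Polynomial.eval₂_mul, hρ, zero_mul]
  choose N R hR using hd
  let ψ (a : A) : F := (R a).eval₂ y ρ / y d ^ N a
  have key (a : A) (M : ℕ) (S : Polynomial B) (h : d ^ M • a = Polynomial.aeval α S) :
      y d ^ M * ψ a = S.eval₂ y ρ := by
    have h1 := hzero (Polynomial.C (d ^ M) * R a - Polynomial.C (d ^ N a) * S) (by
      rw [map_sub, map_mul, map_mul, ← hR, ← h, Polynomial.aeval_C, Polynomial.aeval_C]
      simp only [Algebra.smul_def, map_pow]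
      ring)
    rw [Polynomial.eval₂_sub, Polynomial.eval₂_mul, Polynomial.eval₂_mul, Polynomial.eval₂_C,
      Polynomial.eval₂_C, map_pow, map_pow, sub_eq_zero] at h1
    rw [← mul_div_assoc, h1, mul_div_cancel_left₀ _ (pow_ne_zero _ hy)]
  have key0 (a : A) (S : Polynomial B) (h : a = Polynomial.aeval α S) : ψ a = S.eval₂ y ρ := by
    have := key a 0 S (by rw [pow_zero, one_smul, h])
    rwa [pow_zero, one_mul] at this
  refine ⟨⟨⟨⟨ψ, ?_⟩, fun a b => ?_⟩, ?_, fun a b => ?_⟩, ?_, ?_⟩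
  · rw [key0 1 1 (by simp), Polynomial.eval₂_one]
  · have h1 := key (a * b) (N a + N b) (R a * R b) (by
      rw [map_mul, ← hR, ← hR]
      simp only [Algebra.smul_def, map_pow]
      ring)
    rw [Polynomial.eval₂_mul, ← key a _ _ (hR a), ← key b _ _ (hR b)] at h1
    apply mul_left_cancel₀ (pow_ne_zero (N a + N b) hy)
    rw [h1]
    ring
  · exact (key0 0 0 (by simp)).trans (Polynomial.eval₂_zero _ _)
  · have h1 := key (a + b) (N a + N b)
      (Polynomial.C (d ^ N b) * R a + Polynomial.C (d ^ N a) * R b) (by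
      rw [map_add, map_mul, map_mul, ← hR, ← hR, Polynomial.aeval_C, Polynomial.aeval_C]
      simp only [Algebra.smul_def, map_pow]
      ring)
    rw [Polynomial.eval₂_add, Polynomial.eval₂_mul, Polynomial.eval₂_mul, Polynomial.eval₂_C,
      Polynomial.eval₂_C, ← key a _ _ (hR a), ← key b _ _ (hR b), map_pow, map_pow] at h1
    apply mul_left_cancel₀ (pow_ne_zero (N a + N b) hy)
    refine h1.trans ?_
    change _ = y d ^ (N a + N b) * (ψ a + ψ b)
    ring
  · ext b
    exact (key0 _ (Polynomial.C b) (by simp)).trans (Polynomial.eval₂_C _ _)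
  · exact (key0 _ Polynomial.X (by simp)).trans (Polynomial.eval₂_X _ _)

/-- The number of extensions of a generic homomorphism to `ℂ`. -/
theorem exists_encard_ringHom_eq [IsIntegrallyClosed B] [CharZero B] [Algebra.IsAlgebraic B A]
    [Algebra.FiniteType B A] : ∃ (k : ℕ) (d : B), d ≠ 0 ∧ ∀ y : B →+* ℂ, y d ≠ 0 →
      {ψ : A →+* ℂ | ψ.comp (algebraMap B A) = y}.encard = k := by
  obtain ⟨α, hα, h1, δ, hδ, u, v, huv⟩ := exists_integral_primitive_element (B := B) (A := A)
  obtain ⟨d, hd, h2⟩ := exists_common_denominator h1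
  -- Extensions correspond to roots of the specialized minimal polynomial: δ keeps the roots
  -- distinct, d lets the image of α determine the extension.
  refine ⟨(minpoly B α).natDegree, δ * d, mul_ne_zero hδ hd, fun y hy => ?_⟩
  rw [map_mul] at hy
  set m := (minpoly B α).map y with hm
  have hmonic : m.Monic := (minpoly.monic hα).map y
  have hdeg : m.natDegree = (minpoly B α).natDegree := (minpoly.monic hα).natDegree_map y
  have hsep : m.Separable := by
    refine ⟨Polynomial.C (y δ)⁻¹ * u.map y, Polynomial.C (y δ)⁻¹ * v.map y, ?_⟩
    have h3 := congrArg (Polynomial.map y) huv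
    rw [Polynomial.map_add, Polynomial.map_mul, Polynomial.map_mul, ← Polynomial.derivative_map,
      Polynomial.map_C, ← hm] at h3
    rw [mul_assoc, mul_assoc, ← mul_add, h3, ← Polynomial.C_mul,
      inv_mul_cancel₀ (left_ne_zero_of_mul hy), Polynomial.C_1]
  have hcard : (m.rootSet ℂ).encard = (minpoly B α).natDegree := by
    rw [← hdeg, ← Polynomial.card_rootSet_eq_natDegree (K := ℂ) hsep
      (IsAlgClosed.splits _), Set.encard_eq_coe_toFinset_card, Set.toFinset_card]
  rw [← hcard]
  have hroot (ρ : ℂ) : ρ ∈ m.rootSet ℂ ↔ (minpoly B α).eval₂ y ρ = 0 := by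
    rw [Polynomial.mem_rootSet_of_ne hmonic.ne_zero, Polynomial.coe_aeval_eq_eval, hm,
      Polynomial.eval_map]
  have heval (ψ : A →+* ℂ) (hψ : ψ.comp (algebraMap B A) = y) (R : Polynomial B) :
      ψ (Polynomial.aeval α R) = R.eval₂ y (ψ α) := by
    rw [← hψ, Polynomial.aeval_def, Polynomial.hom_eval₂]
  have hbij : Set.BijOn (fun ψ : A →+* ℂ => ψ α) {ψ : A →+* ℂ | ψ.comp (algebraMap B A) = y}
      (m.rootSet ℂ) := by
    refine ⟨fun ψ hψ => ?_, fun ψ hψ ψ' hψ' h => ?_, fun ρ hρ => ?_⟩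
    · rw [hroot, ← heval ψ hψ, minpoly.aeval, map_zero]
    · ext a
      obtain ⟨N, R, hR⟩ := h2 a
      have e1 := heval ψ hψ R
      have e2 := heval ψ' hψ' R
      have hψd (χ : A →+* ℂ) (hχ : χ.comp (algebraMap B A) = y) :
          χ (d ^ N • a) = y d ^ N * χ a := by
        rw [Algebra.smul_def, map_mul, ← hχ, map_pow, map_pow]
        rfl
      change ψ α = ψ' α at h
      rw [← hR, hψd ψ hψ, h, ← e2, ← hR, hψd ψ' hψ'] at e1
      exact mul_left_cancel₀ (pow_ne_zero N (right_ne_zero_of_mul hy)) e1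
    · obtain ⟨ψ, hψ, hψα⟩ := exists_ringHom_of_root hα h2 y (right_ne_zero_of_mul hy) ρ
        ((hroot ρ).1 hρ)
      exact ⟨ψ, hψ, hψα⟩
  rw [← hbij.image_eq, hbij.injOn.encard_image]

end GenericFibre

/-! ### Images and fibres of polynomial maps to affine space -/

section PolynomialMaps

variable {σ τ : Type}

theorem isTranscendenceBasis_of_trdeg_le_card [Fintype τ] {A : Type} [CommRing A] [IsDomain A]
    [Algebra ℂ A] {a : τ → A} (ha : AlgebraicIndependent ℂ a)
    (h : Algebra.trdeg ℂ A ≤ Fintype.card τ) : IsTranscendenceBasis ℂ a :=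
  ha.isTranscendenceBasis_of_trdeg_le (h.trans_lt Cardinal.natCast_lt_aleph0) (by simpa using h)

theorem aeval_mk_comp (P : Ideal (MvPolynomial σ ℂ)) (φ : τ → MvPolynomial σ ℂ)
    (Q : MvPolynomial τ ℂ) :
    aeval (fun j => Ideal.Quotient.mk P (φ j)) Q = Ideal.Quotient.mk P (aeval φ Q) :=
  (comp_aeval_apply φ (Ideal.Quotient.mkₐ ℂ P) Q).symm

theorem aeval_aeval (x : σ → ℂ) (φ : τ → MvPolynomial σ ℂ) (Q : MvPolynomial τ ℂ) :
    aeval x (aeval φ Q) = aeval (fun j => aeval x (φ j)) Q :=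
  comp_aeval_apply φ (aeval x) Q

/-- The image of a proper closed subset under a polynomial map to an affine space of the same
dimension lies in a proper closed subset. -/
theorem exists_ne_zero_of_notMem [Fintype τ] (P : Ideal (MvPolynomial σ ℂ)) [P.IsPrime]
    (φ : τ → MvPolynomial σ ℂ)
    (h : Algebra.trdeg ℂ (MvPolynomial σ ℂ ⧸ P) ≤ Fintype.card τ) {f : MvPolynomial σ ℂ}
    (hf : f ∉ P) : ∃ Q : MvPolynomial τ ℂ, Q ≠ 0 ∧ ∀ x ∈ zeroLocus ℂ P, aeval x f = 0 →
      aeval (fun j => aeval x (φ j)) Q = 0 := by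
  -- In the dominant case the coordinate ring is algebraic over the target coordinates, so `f`
  -- divides a nonzero polynomial in them. Otherwise a relation between the coordinates already
  -- vanishes on the whole image.
  by_cases ha : AlgebraicIndependent ℂ (fun j => Ideal.Quotient.mk P (φ j))
  · have := (isTranscendenceBasis_of_trdeg_le_card ha h).isAlgebraic
    obtain ⟨Q, hQ, g, hg⟩ := exists_dvd_aeval_of_isAlgebraic (fun j => Ideal.Quotient.mk P (φ j))
      (y := Ideal.Quotient.mk P f) (by rwa [Ne, Ideal.Quotient.eq_zero_iff_mem])
    obtain ⟨g, rfl⟩ := Ideal.Quotient.mk_surjective g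
    refine ⟨Q, hQ, fun x hx hfx => ?_⟩
    rw [aeval_mk_comp, ← map_mul, Ideal.Quotient.eq] at hg
    have h1 := hx _ hg
    rwa [map_sub, map_mul, hfx, zero_mul, sub_zero, aeval_aeval] at h1
  · rw [algebraicIndependent_iff] at ha
    push Not at ha
    obtain ⟨Q, hQ, hQ0⟩ := ha
    refine ⟨Q, hQ0, fun x hx _ => ?_⟩
    rw [aeval_mk_comp, Ideal.Quotient.eq_zero_iff_mem] at hQ
    rw [← aeval_aeval]
    exact hx _ hQ

/-- The fibres of a polynomial map to an affine space of the same dimension have generically the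
same number of points. -/
theorem exists_encard_fibre_eq [Finite σ] [Fintype τ] (P : Ideal (MvPolynomial σ ℂ)) [P.IsPrime]
    (φ : τ → MvPolynomial σ ℂ)
    (h : Algebra.trdeg ℂ (MvPolynomial σ ℂ ⧸ P) ≤ Fintype.card τ) :
    ∃ (k : ℕ) (Q : MvPolynomial τ ℂ), Q ≠ 0 ∧ ∀ y : τ → ℂ, aeval y Q ≠ 0 →
      {x | x ∈ zeroLocus ℂ P ∧ (fun j => aeval x (φ j)) = y}.encard = k := by
  by_cases ha : AlgebraicIndependent ℂ (fun j => Ideal.Quotient.mk P (φ j))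
  · let i : MvPolynomial τ ℂ →ₐ[ℂ] MvPolynomial σ ℂ ⧸ P :=
      aeval fun j => Ideal.Quotient.mk P (φ j)
    let _ : Algebra (MvPolynomial τ ℂ) (MvPolynomial σ ℂ ⧸ P) := i.toRingHom.toAlgebra
    have : IsScalarTower ℂ (MvPolynomial τ ℂ) (MvPolynomial σ ℂ ⧸ P) :=
      .of_algebraMap_eq fun x => (i.commutes x).symm
    have : FaithfulSMul (MvPolynomial τ ℂ) (MvPolynomial σ ℂ ⧸ P) :=
      (faithfulSMul_iff_algebraMap_injective _ _).2 ha
    have : Algebra.FiniteType (MvPolynomial τ ℂ) (MvPolynomial σ ℂ ⧸ P) :=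
      .of_restrictScalars_finiteType ℂ _ _
    have hb := (isTranscendenceBasis_of_trdeg_le_card ha h).isAlgebraic
    have : Algebra.IsAlgebraic (MvPolynomial τ ℂ) (MvPolynomial σ ℂ ⧸ P) := by
      refine Algebra.IsAlgebraic.of_ringHom_of_comp_eq ha.aevalEquiv (RingHom.id _)
        ha.aevalEquiv.surjective Function.injective_id ?_
      exact RingHom.ext fun x => ha.algebraMap_aevalEquiv x
    obtain ⟨k, Q, hQ, hk⟩ := exists_encard_ringHom_eq (B := MvPolynomial τ ℂ)
      (A := MvPolynomial σ ℂ ⧸ P)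
    refine ⟨k, Q, hQ, fun y hy => ?_⟩
    rw [← hk (aeval y : MvPolynomial τ ℂ →ₐ[ℂ] ℂ).toRingHom hy]
    have hbij : Set.BijOn (fun (ψ : MvPolynomial σ ℂ ⧸ P →+* ℂ) (j : σ) =>
        ψ (Ideal.Quotient.mk P (MvPolynomial.X j)))
        {ψ | ψ.comp (algebraMap (MvPolynomial τ ℂ) (MvPolynomial σ ℂ ⧸ P)) =
          (aeval y : MvPolynomial τ ℂ →ₐ[ℂ] ℂ).toRingHom}
        {x | x ∈ zeroLocus ℂ P ∧ (fun j => aeval x (φ j)) = y} := by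
      have key (ψ : MvPolynomial σ ℂ ⧸ P →+* ℂ)
          (hψ : ψ.comp (algebraMap (MvPolynomial τ ℂ) (MvPolynomial σ ℂ ⧸ P)) =
            (aeval y : MvPolynomial τ ℂ →ₐ[ℂ] ℂ).toRingHom) (f : MvPolynomial σ ℂ) :
          ψ (Ideal.Quotient.mk P f) =
            aeval (fun j => ψ (Ideal.Quotient.mk P (MvPolynomial.X j))) f := by
        induction f using MvPolynomial.induction_on with
        | C a =>
          have h1 := DFunLike.congr_fun hψ (C a)
          change ψ (i (C a)) = aeval y (C a) at h1
          rw [algHom_C, algHom_C] at h1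
          rw [algHom_C, ← h1]
          rfl
        | add p q hp hq => simp only [map_add, hp, hq]
        | mul_X p j hp => simp only [map_mul, hp, aeval_X]
      refine ⟨fun ψ hψ => ⟨fun f hf => ?_, ?_⟩, fun ψ hψ ψ' hψ' h => ?_, fun x hx => ?_⟩
      · rw [← key ψ hψ, Ideal.Quotient.eq_zero_iff_mem.2 hf, map_zero]
      · ext j
        rw [← key ψ hψ]
        have h1 := DFunLike.congr_fun hψ (MvPolynomial.X j)
        change ψ (i (MvPolynomial.X j)) = aeval y (MvPolynomial.X j) at h1
        rwa [aeval_X, aeval_X] at h1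
      · ext f
        · have e1 := key ψ hψ (C f)
          have e2 := key ψ' hψ' (C f)
          rw [algHom_C] at e1 e2
          exact e1.trans e2.symm
        · exact congrFun h f
      · have hL : ∀ f ∈ P, (aeval x : MvPolynomial σ ℂ →ₐ[ℂ] ℂ).toRingHom f = 0 :=
          fun f hf => hx.1 f hf
        refine ⟨Ideal.Quotient.lift P _ hL, ?_, ?_⟩
        · refine MvPolynomial.ringHom_ext (fun a => ?_) fun j => ?_
          · change Ideal.Quotient.lift P _ hL (i (C a)) = aeval y (C a)
            rw [algHom_C, algHom_C]
            exact algHom_C (aeval x) a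
          · change Ideal.Quotient.lift P _ hL (i (MvPolynomial.X j)) = aeval y (MvPolynomial.X j)
            rw [aeval_X, aeval_X, ← hx.2]
            rfl
        · ext j
          exact aeval_X x j
    rw [← hbij.image_eq, hbij.injOn.encard_image]
  · rw [algebraicIndependent_iff] at ha
    push Not at ha
    obtain ⟨Q, hQ, hQ0⟩ := ha
    -- The map is not dominant: the generic fibre is empty.
    refine ⟨0, Q, hQ0, fun y hy => ?_⟩
    rw [Nat.cast_zero, Set.encard_eq_zero, Set.eq_empty_iff_forall_notMem]
    rintro x ⟨hx, rfl⟩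
    apply hy
    rw [aeval_mk_comp, Ideal.Quotient.eq_zero_iff_mem] at hQ
    rw [← aeval_aeval]
    exact hx _ hQ

end PolynomialMaps

/-! ### Irreducibility and dimension of products with a conjugated factor -/

section Products

variable {σ τ υ : Type}

/-- For each a, irreducibility of B makes F or G vanish on the slice through a. Testing at b₀ and b₁
covers A by two closed sets, and irreducibility of A makes one of them everything. -/
theorem isPrime_vanishingIdeal_image2 {A : Set (σ → ℂ)} {B : Set (τ → ℂ)}
    (hA : (vanishingIdeal ℂ A).IsPrime) (hB : (vanishingIdeal ℂ B).IsPrime)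
    {J : (σ → ℂ) → (τ → ℂ) → υ → ℂ} (h1 : ∀ b, ZariskiContinuous fun a => J a b)
    (h2 : ∀ a, ZariskiContinuous (J a)) : (vanishingIdeal ℂ (Set.image2 J A B)).IsPrime := by
  have hne {ρ : Type} {S : Set (ρ → ℂ)} (hS : (vanishingIdeal ℂ S).IsPrime) : S.Nonempty := by
    rw [Set.nonempty_iff_ne_empty]
    rintro rfl
    exact hS.ne_top vanishingIdeal_empty
  refine ⟨fun htop => ?_, fun {F G} hFG => ?_⟩
  · obtain ⟨a, ha⟩ := hne hA
    obtain ⟨b, hb⟩ := hne hB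
    have h3 : (1 : MvPolynomial υ ℂ) ∈ vanishingIdeal ℂ (Set.image2 J A B) := by
      rw [htop]
      trivial
    have := h3 _ ⟨a, ha, b, hb, rfl⟩
    rw [map_one] at this
    exact one_ne_zero this
  · by_contra! hcon
    obtain ⟨hF, hG⟩ := hcon
    simp only [mem_vanishingIdeal_iff, Set.forall_mem_image2] at hF hG hFG
    push Not at hF hG
    obtain ⟨a₀, ha₀, b₀, hb₀, hF⟩ := hF
    obtain ⟨a₁, ha₁, b₁, hb₁, hG⟩ := hG
    obtain ⟨f, hf⟩ := h1 b₀ F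
    obtain ⟨g, hg⟩ := h1 b₁ G
    have hfg : f * g ∈ vanishingIdeal ℂ A := by
      intro a ha
      obtain ⟨f', hf'⟩ := h2 a F
      obtain ⟨g', hg'⟩ := h2 a G
      have hfg' : f' * g' ∈ vanishingIdeal ℂ B := by
        intro b hb
        have h3 := hFG a ha b hb
        rw [map_mul, mul_eq_zero] at h3 ⊢
        rwa [hf', hg']
      rw [map_mul, mul_eq_zero, hf, hg]
      rcases hB.mem_or_mem hfg' with h | h
      · exact Or.inl ((hf' _).1 (h b₀ hb₀))
      · exact Or.inr ((hg' _).1 (h b₁ hb₁))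
    rcases hA.mem_or_mem hfg with h | h
    · exact hF ((hf _).1 (h a₀ ha₀))
    · exact hG ((hg _).1 (h a₁ ha₁))

/-- Semilinearity is allowed because the second conormal factor enters the incidence variety through
complex conjugation. -/
theorem trdeg_le_of_semilinear_surjective {A B : Type} [CommRing A] [CommRing B] [IsDomain B]
    [Algebra ℂ A] [Algebra ℂ B] (s : ℂ →+* ℂ) (g : A →+* B) (hg : Function.Surjective g)
    (h : (algebraMap ℂ B).comp s = g.comp (algebraMap ℂ A)) :
    Algebra.trdeg ℂ B ≤ Algebra.trdeg ℂ A := by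
  obtain ⟨S, hS⟩ := exists_isTranscendenceBasis ℂ B
  choose a ha using fun b : S => hg b
  have hind : AlgebraicIndependent ℂ a := AlgebraicIndependent.of_ringHom_of_comp_eq s g
    (by rw [show g ∘ a = Subtype.val from funext ha]; exact hS.1) s.injective h
  rw [← hS.cardinalMk_eq_trdeg]
  exact hind.cardinalMk_le_trdeg

/-- Everything is algebraic over the union of transcendence bases of the two subalgebras. -/
theorem trdeg_le_add {Q : Type} [CommRing Q] [IsDomain Q] [Algebra ℂ Q] (U V : Subalgebra ℂ Q)
    (h : U ⊔ V = ⊤) : Algebra.trdeg ℂ Q ≤ Algebra.trdeg ℂ U + Algebra.trdeg ℂ V := by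
  have hfaith (U : Subalgebra ℂ Q) : FaithfulSMul ℂ U :=
    (faithfulSMul_iff_algebraMap_injective _ _).2 (algebraMap ℂ U).injective
  have := hfaith U
  have := hfaith V
  obtain ⟨S, hS⟩ := exists_isTranscendenceBasis ℂ U
  obtain ⟨T, hT⟩ := exists_isTranscendenceBasis ℂ V
  set W : Set Q := (Subtype.val '' S) ∪ (Subtype.val '' T) with hW
  have aux (U : Subalgebra ℂ Q) (S : Set U) (hS : IsTranscendenceBasis ℂ ((↑) : S → U))
      (hSW : Subtype.val '' S ⊆ W) :
      U ≤ (Subalgebra.algebraicClosure (Algebra.adjoin ℂ W) Q).restrictScalars ℂ := by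
    intro x hx
    have h1 := hS.isAlgebraic.isAlgebraic ⟨x, hx⟩
    rw [Subtype.range_coe] at h1
    have hle (y : Algebra.adjoin ℂ S) : U.val (y : U) ∈ Algebra.adjoin ℂ W := by
      have h2 : U.val y ∈ (Algebra.adjoin ℂ S).map U.val := ⟨y, y.2, rfl⟩
      rw [← Algebra.adjoin_image] at h2
      exact Algebra.adjoin_mono hSW h2
    let f : Algebra.adjoin ℂ S →ₐ[ℂ] Algebra.adjoin ℂ W :=
      (U.val.comp (Algebra.adjoin ℂ S).val).codRestrict _ hle
    exact h1.ringHom_of_comp_eq f U.val (fun a b hab => Subtype.val_injective <|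
      Subtype.val_injective (show ((a : U) : Q) = b from congrArg (Subtype.val : Algebra.adjoin ℂ W → Q) hab)) rfl
  have hUV := sup_le (aux U S hS Set.subset_union_left) (aux V T hT Set.subset_union_right)
  rw [h] at hUV
  have : Algebra.IsAlgebraic (Algebra.adjoin ℂ W) Q := ⟨fun x => hUV (Algebra.mem_top (x := x))⟩
  refine (Algebra.IsAlgebraic.trdeg_le_cardinalMk ℂ W).trans ?_
  refine (Cardinal.mk_union_le _ _).trans (add_le_add ?_ ?_)
  · exact Cardinal.mk_image_le.trans_eq hS.cardinalMk_eq_trdeg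
  · exact Cardinal.mk_image_le.trans_eq hT.cardinalMk_eq_trdeg

end Products

theorem trdeg_le_add_of_generate {A Q : Type} [CommRing A] [CommRing Q] [IsDomain Q] [Algebra ℂ A]
    [Algebra ℂ Q] (α : A →ₐ[ℂ] Q) (s : ℂ →+* ℂ) (hs : Function.Surjective s) (β : A →+* Q)
    (h : (algebraMap ℂ Q).comp s = β.comp (algebraMap ℂ A))
    (hgen : ∀ W : Subalgebra ℂ Q, (∀ a, α a ∈ W) → (∀ a, β a ∈ W) → ∀ x, x ∈ W) :
    Algebra.trdeg ℂ Q ≤ Algebra.trdeg ℂ A + Algebra.trdeg ℂ A := by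
  let V : Subalgebra ℂ Q :=
    { β.range with
      algebraMap_mem' := fun c => by
        obtain ⟨c, rfl⟩ := hs c
        exact ⟨algebraMap ℂ A c, (DFunLike.congr_fun h c).symm⟩ }
  have hV (a : A) : β a ∈ V := ⟨a, rfl⟩
  have htop : α.range ⊔ V = ⊤ := by
    refine eq_top_iff.2 fun x _ => hgen _ (fun a => ?_) (fun a => ?_) x
    · exact (le_sup_left : α.range ≤ _) ⟨a, rfl⟩
    · exact (le_sup_right : V ≤ _) (hV a)
  refine (trdeg_le_add _ _ htop).trans (add_le_add ?_ ?_)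
  · exact trdeg_le_of_semilinear_surjective (RingHom.id ℂ) α.rangeRestrict.toRingHom
      α.rangeRestrict_surjective (RingHom.ext fun c => (α.rangeRestrict.commutes c).symm)
  · refine trdeg_le_of_semilinear_surjective s (β.codRestrict V hV) ?_ ?_
    · rintro ⟨_, a, rfl⟩
      exact ⟨a, rfl⟩
    · exact RingHom.ext fun c => Subtype.ext (DFunLike.congr_fun h c)

/-! ### The incidence variety of data and solutions -/

variable {n : ℕ} {X : Set (Fin n → ℂ)}

theorem vanishingIdeal_regCritical_isPrime [hp : (idealOf X).IsPrime] :
    (vanishingIdeal ℂ (regCritical X)).IsPrime := by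
  have h := vanishingIdeal_regConormal_isPrime X
  rw [regCritical_eq_image2]
  exact isPrime_vanishingIdeal_image2 h h zariskiContinuous_joinPoint_left
    zariskiContinuous_joinPoint_right

def conormalCoords (n : ℕ) : Fin n ⊕ Fin n → Ring4 n :=
  Sum.elim (fun i => MvPolynomial.X (0, i)) fun i => MvPolynomial.X (3, i) - MvPolynomial.X (1, i)

theorem aeval_conormalCoords (q : Fin 4 × Fin n → ℂ) (F : MvPolynomial (Fin n ⊕ Fin n) ℂ) :
    aeval q (aeval (conormalCoords n) F) = aeval (conormalPoint q) F := by
  rw [aeval_aeval]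
  congr 2
  ext (i | i) <;> simp [conormalCoords, conormalPoint]

/-- The coordinates z and v - w come from one copy of the conormal ring, w and u - z from a
conjugated copy. Together they generate, so the dimension is at most n + n. -/
theorem trdeg_regCritical [hp : (idealOf X).IsPrime] :
    Algebra.trdeg ℂ (Ring4 n ⧸ vanishingIdeal ℂ (regCritical X)) ≤
      Fintype.card (Fin n ⊕ Fin n) := by
  have hprime := vanishingIdeal_regCritical_isPrime (X := X)
  have h1 := trdeg_conormal X
  set J := vanishingIdeal ℂ (regConormal X)
  set I := vanishingIdeal ℂ (regCritical X)
  have hα : ∀ F ∈ J, Ideal.Quotient.mkₐ ℂ I (aeval (conormalCoords n) F) = 0 := by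
    intro F hF
    refine Ideal.Quotient.eq_zero_iff_mem.2 fun q hq => ?_
    rw [aeval_conormalCoords]
    exact hF _ hq.1
  have hβ : ∀ F ∈ J, Ideal.Quotient.mk I (starMap n (aeval (conormalCoords n) F)) = 0 := by
    intro F hF
    refine Ideal.Quotient.eq_zero_iff_mem.2 fun q hq => ?_
    rw [aeval_starMap, aeval_conormalCoords, hF _ hq.2, star_zero]
  let α : (MvPolynomial (Fin n ⊕ Fin n) ℂ ⧸ J) →ₐ[ℂ] (Ring4 n ⧸ I) :=
    Ideal.Quotient.liftₐ J ((Ideal.Quotient.mkₐ ℂ I).comp (aeval (conormalCoords n))) hα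
  let β : (MvPolynomial (Fin n ⊕ Fin n) ℂ ⧸ J) →+* (Ring4 n ⧸ I) :=
    Ideal.Quotient.lift J ((Ideal.Quotient.mk I).comp
      ((starMap n).comp (aeval (conormalCoords n) : _ →ₐ[ℂ] Ring4 n).toRingHom)) hβ
  have h2 := trdeg_le_add_of_generate α (starRingEnd ℂ) (starRingEnd ℂ).surjective β ?_ ?_
  · rw [h1] at h2
    simpa using h2
  · refine RingHom.ext fun c => ?_
    change Ideal.Quotient.mk I (C (starRingEnd ℂ c)) =
      Ideal.Quotient.mk I (starMap n (aeval (conormalCoords n) (C c)))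
    rw [algHom_C]
    congr 1
    change _ = rename _ (map (starRingEnd ℂ) (C c))
    rw [map_C, rename_C]
  · intro W hα hβ x
    obtain ⟨f, rfl⟩ := Ideal.Quotient.mk_surjective x
    have e0 (i : Fin n) : Ideal.Quotient.mk I (MvPolynomial.X (0, i)) ∈ W := by
      have := hα (Ideal.Quotient.mk J (MvPolynomial.X (Sum.inl i)))
      change Ideal.Quotient.mk I (aeval (conormalCoords n) (MvPolynomial.X (Sum.inl i))) ∈ W at this
      rwa [aeval_X] at this
    have e1 (i : Fin n) : Ideal.Quotient.mk I (MvPolynomial.X (1, i)) ∈ W := by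
      have := hβ (Ideal.Quotient.mk J (MvPolynomial.X (Sum.inl i)))
      change Ideal.Quotient.mk I (starMap n (aeval (conormalCoords n)
        (MvPolynomial.X (Sum.inl i)))) ∈ W at this
      rw [aeval_X] at this
      simpa [starMap, conormalCoords] using this
    have e2 (i : Fin n) : Ideal.Quotient.mk I (MvPolynomial.X (2, i)) ∈ W := by
      have := hβ (Ideal.Quotient.mk J (MvPolynomial.X (Sum.inr i)))
      change Ideal.Quotient.mk I (starMap n (aeval (conormalCoords n)
        (MvPolynomial.X (Sum.inr i)))) ∈ W at this
      rw [aeval_X] at this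
      have := add_mem this (e0 i)
      simpa [starMap, conormalCoords] using this
    have e3 (i : Fin n) : Ideal.Quotient.mk I (MvPolynomial.X (3, i)) ∈ W := by
      have := hα (Ideal.Quotient.mk J (MvPolynomial.X (Sum.inr i)))
      change Ideal.Quotient.mk I (aeval (conormalCoords n) (MvPolynomial.X (Sum.inr i))) ∈ W at this
      rw [aeval_X] at this
      have := add_mem this (e1 i)
      simpa [conormalCoords] using this
    induction f using MvPolynomial.induction_on with
    | C a => exact W.algebraMap_mem a
    | add p q hp hq => rw [map_add]; exact add_mem hp hq
    | mul_X p j hp =>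
      rw [map_mul]
      refine mul_mem hp ?_
      obtain ⟨k, i⟩ := j
      fin_cases k
      exacts [e0 i, e1 i, e2 i, e3 i]

/-! ### The duality bijection on solutions -/

variable {n : ℕ} {X : Set (Fin n → ℂ)}

/-- The two conormal conditions for the image are those for (z, w) with entries swapped, so
biduality applies to each. The inverse has the same form with u and v exchanged. -/
theorem bijOn_solutions (hX : IsIrreducibleAffineCone X) (u v : Fin n → ℂ) :
    Set.BijOn (fun p : (Fin n → ℂ) × (Fin n → ℂ) => (v - p.2, u - p.1)) (solutions X u v)
      (solutions (dualVariety X) v u) := by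
  have key (p : (Fin n → ℂ) × (Fin n → ℂ)) :
      (v - p.2, u - p.1) ∈ solutions (dualVariety X) v u ↔ p ∈ solutions X u v := by
    rw [mem_solutions_iff hX, mem_solutions_iff (dualVariety_isIrreducibleAffineCone hX)]
    simp only [sub_sub_cancel, star_sub]
    rw [mem_conormal_dualVariety_iff hX, mem_conormal_dualVariety_iff hX]
  refine ⟨fun p hp => (key p).2 hp, fun p _ q _ h => ?_, fun p hp => ?_⟩
  · simp only [Prod.mk.injEq, sub_right_inj] at h
    exact Prod.ext h.2 h.1
  · refine ⟨(u - p.2, v - p.1), (key _).1 ?_, ?_⟩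
    · simpa using hp
    · simp

theorem mem_conjSolutions_iff (hX : IsIrreducibleAffineCone X) {u : Fin n → ℂ}
    {p : (Fin n → ℂ) × (Fin n → ℂ)} : p ∈ conjSolutions X u ↔
      Sum.elim p.1 (star u - star p.1) ∈ conormal X ∧ p.2 = star p.1 := by
  refine and_congr_left fun h => ?_
  rw [mem_solutions_iff hX, h, star_star, and_self]

theorem bijOn_conjSolutions (hX : IsIrreducibleAffineCone X) (u : Fin n → ℂ) :
    Set.BijOn (fun p : (Fin n → ℂ) × (Fin n → ℂ) => (star u - p.2, u - p.1)) (conjSolutions X u)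
      (conjSolutions (dualVariety X) (star u)) := by
  have h := bijOn_solutions hX u (star u)
  refine ⟨fun p hp => ⟨?_, ?_⟩, h.injOn.mono fun p hp => hp.1, fun p hp => ?_⟩
  · rw [star_star]
    exact h.mapsTo hp.1
  · simp [hp.2]
  · obtain ⟨hp1, hp2⟩ := hp
    rw [star_star] at hp1
    obtain ⟨q, hq, rfl⟩ := h.surjOn hp1
    refine ⟨q, ⟨hq, ?_⟩, rfl⟩
    have h2 : u - q.1 = u - star q.2 := by simpa using hp2
    rw [sub_right_inj.1 h2, star_star]

/-! ### Existence and duality of the virtual degree -/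

section Degree

def dataCoords (n : ℕ) : Fin n ⊕ Fin n → Ring4 n :=
  Sum.elim (fun i => MvPolynomial.X (2, i)) fun i => MvPolynomial.X (3, i)

theorem aeval_dataCoords (q : Fin 4 × Fin n → ℂ) :
    (fun j => aeval q (dataCoords n j)) = Sum.elim (fun i => q (2, i)) fun i => q (3, i) := by
  ext (i | i) <;> simp [dataCoords]

theorem exists_hasVHD (hX : IsIrreducibleAffineCone X) : ∃ k, HasVHD X k := by
  have hp := hX.isPrime
  have hprime := vanishingIdeal_regCritical_isPrime (X := X)
  obtain ⟨k, Q, hQ, hk⟩ := exists_encard_fibre_eq (vanishingIdeal ℂ (regCritical X)) (dataCoords n)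
    trdeg_regCritical
  refine ⟨k, Q, hQ, fun u v huv => ?_⟩
  rw [← hk (Sum.elim u v) huv]
  have hbij : Set.BijOn (fun (p : (Fin n → ℂ) × (Fin n → ℂ)) (a : Fin 4 × Fin n) =>
      (![p.1, p.2, u, v] : Fin 4 → Fin n → ℂ) a.1 a.2) (solutions X u v)
      {x | x ∈ zeroLocus ℂ (vanishingIdeal ℂ (regCritical X)) ∧
        (fun j => aeval x (dataCoords n j)) = Sum.elim u v} := by
    refine ⟨fun p hp => ⟨?_, ?_⟩, fun p _ q _ h => ?_, fun x hx => ?_⟩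
    · exact (zeroLocus_criticalIdeal hX.isClosed).subset hp
    · rw [aeval_dataCoords]
      rfl
    · exact Prod.ext (funext fun i => congrFun h (0, i)) (funext fun i => congrFun h (1, i))
    · obtain ⟨hx1, hx2⟩ := hx
      rw [aeval_dataCoords] at hx2
      have e : (fun a : Fin 4 × Fin n => (![fun i => x (0, i), fun i => x (1, i), u, v] :
          Fin 4 → Fin n → ℂ) a.1 a.2) = x := by
        ext ⟨k, i⟩
        fin_cases k
        exacts [rfl, rfl, (congrFun hx2 (Sum.inl i)).symm, (congrFun hx2 (Sum.inr i)).symm]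
      refine ⟨(fun i => x (0, i), fun i => x (1, i)), ?_, e⟩
      change (fun a : Fin 4 × Fin n => (![fun i => x (0, i), fun i => x (1, i), u, v] :
          Fin 4 → Fin n → ℂ) a.1 a.2) ∈ zeroLocus ℂ (criticalIdeal X)
      rw [e, zeroLocus_criticalIdeal hX.isClosed]
      exact hx1
  rw [← hbij.image_eq, hbij.injOn.encard_image]

/-- Two nonempty Zariski open sets of data meet, since a product of nonzero polynomials is nonzero
somewhere. -/
theorem HasVHD.unique {k k' : ℕ} (h : HasVHD X k) (h' : HasVHD X k') : k = k' := by
  obtain ⟨P, hP, hk⟩ := h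
  obtain ⟨P', hP', hk'⟩ := h'
  obtain ⟨x, hx⟩ : ∃ x, eval x (P * P') ≠ 0 := by
    by_contra! h
    exact mul_ne_zero hP hP' (MvPolynomial.funext fun x => by rw [h, map_zero])
  rw [map_mul, mul_ne_zero_iff, ← Sum.elim_comp_inl_inr x] at hx
  have h1 := hk _ _ hx.1
  rw [hk' _ _ hx.2] at h1
  exact_mod_cast h1.symm

theorem HasVHD.vHD_eq {k : ℕ} (h : HasVHD X k) : vHD X = k := by
  have : {k | HasVHD X k} = {k} := Set.eq_singleton_iff_unique_mem.2 ⟨h, fun k' h' => h'.unique h⟩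
  rw [vHD, this, csInf_singleton]

theorem HasVHD.dualVariety (hX : IsIrreducibleAffineCone X) {k : ℕ} (h : HasVHD X k) :
    HasVHD (dualVariety X) k := by
  obtain ⟨P, hP, hk⟩ := h
  refine ⟨rename Sum.swap P, ?_, fun u v huv => ?_⟩
  · rw [Ne, map_eq_zero_iff _ (rename_injective _ Sum.swap_leftInverse.injective)]
    exact hP
  · rw [eval_rename, elim_comp_swap] at huv
    rw [← hk v u huv, ← (bijOn_solutions hX v u).image_eq,
      (bijOn_solutions hX v u).injOn.encard_image]

end Degree

/-! ### The Hermitian norm and its critical points -/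

section Norm

theorem hnorm_sq (z : Fin n → ℂ) : hnorm z ^ 2 = ∑ i, ‖z i‖ ^ 2 :=
  EuclideanSpace.norm_sq_eq _

theorem hnorm_star (z : Fin n → ℂ) : hnorm (star z) = hnorm z := by
  refine (sq_eq_sq₀ (norm_nonneg _) (norm_nonneg _)).1 ?_
  change hnorm _ ^ 2 = hnorm _ ^ 2
  simp [hnorm_sq]

theorem hnorm_sq_sub_add_hnorm_sq {u z : Fin n → ℂ} (h : z ⬝ᵥ (star u - star z) = 0) :
    hnorm (u - z) ^ 2 + hnorm z ^ 2 = hnorm u ^ 2 := by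
  have h1 : ∑ i, (z i * (star (u i) - star (z i))).re = 0 := by
    rw [← Complex.re_sum]
    exact congrArg Complex.re h
  rw [hnorm_sq, hnorm_sq, hnorm_sq, ← Finset.sum_add_distrib, ← sub_eq_zero,
    ← Finset.sum_sub_distrib, ← mul_zero (-2 : ℝ), ← h1, Finset.mul_sum]
  refine Finset.sum_congr rfl fun i _ => ?_
  simp only [← Complex.normSq_eq_norm_sq, Complex.normSq_apply, Pi.sub_apply, Complex.sub_re,
    Complex.sub_im, Complex.mul_re, Complex.star_def, Complex.conj_re, Complex.conj_im]
  ring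

theorem fderiv_hnorm_sq (u z t : Fin n → ℂ) :
    fderiv ℝ (fun x : Fin n → ℂ => hnorm (u - x) ^ 2) z t =
      -2 * ((star u - star z) ⬝ᵥ t).re := by
  have h (i : Fin n) : HasFDerivAt (fun x : Fin n → ℂ => ‖u i - x i‖ ^ 2)
      (2 • (innerSL ℝ (u i - z i)).comp
        (-(ContinuousLinearMap.proj i : (Fin n → ℂ) →L[ℝ] ℂ))) z :=
    ((ContinuousLinearMap.proj i : (Fin n → ℂ) →L[ℝ] ℂ).hasFDerivAt.const_sub (u i)).norm_sq
  have h2 := HasFDerivAt.fun_sum (u := Finset.univ) fun i _ => h i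
  have h3 : (fun x : Fin n → ℂ => hnorm (u - x) ^ 2) = fun x => ∑ i, ‖u i - x i‖ ^ 2 :=
    funext fun x => hnorm_sq _
  rw [h3, h2.fderiv, dotProduct, Complex.re_sum, Finset.mul_sum, sum_apply]
  refine Finset.sum_congr rfl fun i _ => ?_
  simp [Complex.inner]
  ring

theorem mem_criticalPoints_iff {u z : Fin n → ℂ} : z ∈ criticalPoints X u ↔
    z ∈ regLocus X ∧ star u - star z ∈ normalSpace X z := by
  refine and_congr_right fun _ => ?_
  rw [mem_normalSpace_iff]
  simp only [fderiv_hnorm_sq]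
  refine ⟨fun h t ht => ?_, fun h t ht => by rw [h t ht]; simp⟩
  have h1 := h t ht
  -- The real differential sees only real parts; the tangent space is complex, so testing with i·t
  -- recovers the imaginary part.
  have h2 := h (Complex.I • t) fun f hf => by rw [dotProduct_smul, ht f hf, smul_zero]
  rw [dotProduct_smul, smul_eq_mul] at h2
  refine Complex.ext ?_ ?_
  · simpa using h1
  · have h3 : ((star u - star z) ⬝ᵥ t).im = 0 := by simpa [-sub_dotProduct] using h2
    exact h3

end Norm

theorem mem_conjSolutions_of_mem_criticalPoints (hX : IsIrreducibleAffineCone X) {u z : Fin n → ℂ}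
    (h : z ∈ criticalPoints X u) : (z, star z) ∈ conjSolutions X u := by
  rw [mem_criticalPoints_iff] at h
  exact (mem_conjSolutions_iff hX).2 ⟨subset_zcl _ (elim_mem_regConormal h.1 h.2), rfl⟩

/-! ### Generic data of the form (u, ū) and critical points -/

section Generic

theorem isOpen_setOf_aeval_star_ne_zero (Q : MvPolynomial (Fin n ⊕ Fin n) ℂ) :
    IsOpen {u : Fin n → ℂ | eval (Sum.elim u (star u)) Q ≠ 0} := by
  refine isOpen_ne_fun ?_ continuous_const
  refine (MvPolynomial.continuous_eval Q).comp (continuous_pi ?_)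
  rintro (i | i)
  · exact continuous_apply i
  · exact continuous_star.comp (continuous_apply i)

/-- Writing u = a + ib and ū = a - ib turns the pairs (u, ū) into real points, and a polynomial
vanishing on a product of infinite sets, here real intervals, is zero. -/
theorem dense_setOf_aeval_star_ne_zero {Q : MvPolynomial (Fin n ⊕ Fin n) ℂ} (hQ : Q ≠ 0) :
    Dense {u : Fin n → ℂ | eval (Sum.elim u (star u)) Q ≠ 0} := by
  let φ : Fin n ⊕ Fin n → MvPolynomial (Fin n ⊕ Fin n) ℂ := Sum.elim
    (fun i => MvPolynomial.X (Sum.inl i) + C Complex.I * MvPolynomial.X (Sum.inr i))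
    fun i => MvPolynomial.X (Sum.inl i) - C Complex.I * MvPolynomial.X (Sum.inr i)
  have hφ (x : Fin n ⊕ Fin n → ℂ) : eval x (aeval φ Q) =
      eval (Sum.elim (fun i => x (Sum.inl i) + Complex.I * x (Sum.inr i))
        fun i => x (Sum.inl i) - Complex.I * x (Sum.inr i)) Q := by
    refine (aeval_aeval x φ Q).trans ?_
    change eval _ Q = _
    congr 2
    ext (i | i) <;> simp [φ]
  rw [Metric.dense_iff]
  intro c r hr
  by_contra! hcon
  apply hQ
  -- Half-width r/2 in both real and imaginary part keeps |re| + |im|, hence the distance to c,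
  -- below r.
  let s : Fin n ⊕ Fin n → Set ℂ := Sum.elim
    (fun i => (↑) '' Set.Ioo ((c i).re - r / 2) ((c i).re + r / 2))
    fun i => (↑) '' Set.Ioo ((c i).im - r / 2) ((c i).im + r / 2)
  have hs (j) : (s j).Infinite := by
    rcases j with i | i <;>
    exact (Set.Ioo_infinite (by linarith)).image Complex.ofReal_injective.injOn
  have h0 : aeval φ Q = 0 := by
    refine MvPolynomial.funext_set s hs fun x hx => ?_
    have hx' (j) : x j ∈ s j := hx j trivial
    choose a ha hax using fun i => hx' (Sum.inl i)
    choose b hb hbx using fun i => hx' (Sum.inr i)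
    rw [map_zero, hφ]
    by_contra hne
    refine Set.eq_empty_iff_forall_notMem.1 hcon (fun i => a i + Complex.I * b i) ⟨?_, ?_⟩
    · rw [Metric.mem_ball, dist_pi_lt_iff hr]
      intro i
      rw [Complex.dist_eq]
      refine (Complex.norm_le_abs_re_add_abs_im _).trans_lt ?_
      have h1 := ha i
      have h2 := hb i
      have h3 : |a i - (c i).re| < r / 2 := abs_sub_lt_iff.2 ⟨by linarith [h1.2], by linarith [h1.1]⟩
      have h4 : |b i - (c i).im| < r / 2 := abs_sub_lt_iff.2 ⟨by linarith [h2.2], by linarith [h2.1]⟩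
      have : |a i - (c i).re| + |b i - (c i).im| < r := by linarith
      simpa using this
    · change eval _ Q ≠ 0
      convert hne using 3
      ext (i | i)
      · simp [hax, hbx]
      · simp [← hax, ← hbx, sub_eq_add_neg]
  refine MvPolynomial.funext fun y => ?_
  -- The inverse substitution, showing that Q vanishes at an arbitrary point y.
  have h1 := hφ (Sum.elim (fun i => (y (Sum.inl i) + y (Sum.inr i)) / 2)
    fun i => (y (Sum.inl i) - y (Sum.inr i)) / (2 * Complex.I))
  rw [h0, map_zero] at h1
  rw [map_zero, h1]
  congr 2
  ext (i | i)
  · simp only [Sum.elim_inl, Sum.elim_inr]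
    field_simp
    ring
  · simp only [Sum.elim_inl, Sum.elim_inr]
    field_simp
    ring

theorem exists_generic_bijOn_criticalPoints (hX : IsIrreducibleAffineCone X) :
    ∃ O : Set (Fin n → ℂ), IsOpen O ∧ Dense O ∧ ∀ u ∈ O,
      Set.BijOn (fun z : Fin n → ℂ => star u - star z) (criticalPoints X u)
        (criticalPoints (dualVariety X) (star u)) := by
  have hp := hX.isPrime
  have hX' := dualVariety_isIrreducibleAffineCone hX
  have hp' := hX'.isPrime
  have hprime := vanishingIdeal_regCritical_isPrime (X := X)
  have hprime' := vanishingIdeal_regConormal_isPrime X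
  obtain ⟨r, c, hΔ⟩ := exists_jacobian_minor_notMem X
  obtain ⟨r', c', hΔ'⟩ := exists_jacobian_minor_notMem (dualVariety X)
  -- Where F is nonzero, a conormal pair is regular on both sides. The generic `u` are those for
  -- which no solution over (u, ū) meets F = 0.
  set F := rename (R := ℂ) (Sum.inl : _ → Fin n ⊕ Fin n) ((jacobian X).submatrix r c).det *
    rename (Sum.inr : _ → Fin n ⊕ Fin n) ((jacobian (dualVariety X)).submatrix r' c').det with hF
  have hF0 : aeval (conormalCoords n) F ∉ vanishingIdeal ℂ (regCritical X) := by
    intro h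
    have h1 : F ∈ vanishingIdeal ℂ (regConormal X) := by
      intro p hp
      have := h (joinPoint p p) (by
        rw [regCritical_eq_image2]
        exact ⟨p, hp, p, hp, rfl⟩)
      rwa [aeval_conormalCoords, conormalPoint_joinPoint] at this
    rcases hprime'.mem_or_mem h1 with h2 | h2
    · exact notMem_of_notMem_idealOf hΔ h2
    · exact hΔ' (mem_idealOf_dualVariety_iff.2 h2)
  obtain ⟨Q, hQ, hQF⟩ := exists_ne_zero_of_notMem _ (dataCoords n) trdeg_regCritical hF0
  refine ⟨_, isOpen_setOf_aeval_star_ne_zero Q, dense_setOf_aeval_star_ne_zero hQ, fun u hu => ?_⟩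
  have key (z : Fin n → ℂ) (hz : (z, star z) ∈ conjSolutions X u) : z ∈ criticalPoints X u ∧
      star u - star z ∈ criticalPoints (dualVariety X) (star u) := by
    have hC := ((mem_conjSolutions_iff hX).1 hz).1
    dsimp only at hC
    have hq := hz.1
    change _ ∈ zeroLocus ℂ (criticalIdeal X) at hq
    rw [zeroLocus_criticalIdeal hX.isClosed] at hq
    have hne := mt (hQF _ hq) (by
      rw [aeval_dataCoords]
      exact hu)
    rw [aeval_conormalCoords] at hne
    change aeval (Sum.elim z (star u - star z)) F ≠ 0 at hne
    rw [hF, map_mul, aeval_elim_rename_inl, aeval_elim_rename_inr, mul_ne_zero_iff] at hne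
    have hreg : z ∈ regLocus X :=
      mem_regLocus_iff.2 ⟨fst_mem_of_mem_conormal hX.isClosed hC, r, c, hne.1⟩
    rw [mem_criticalPoints_iff, mem_criticalPoints_iff]
    refine ⟨⟨hreg, mem_normalSpace_of_mem_conormal hC hreg⟩,
      mem_regLocus_iff.2 ⟨snd_mem_dualVariety hC, r', c', hne.2⟩, ?_⟩
    have := mem_normalSpace_dualVariety hX hC ⟨r', c', hne.2⟩
    simpa using this
  refine ⟨fun z hz => (key z (mem_conjSolutions_of_mem_criticalPoints hX hz)).2,
    fun z _ z' _ h => star_injective (sub_right_inj.1 h), fun s hs => ?_⟩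
  obtain ⟨p, hp, h⟩ := (bijOn_conjSolutions hX u).surjOn
    (mem_conjSolutions_of_mem_criticalPoints hX' hs)
  have hp2 := hp.2
  obtain ⟨z, w⟩ := p
  dsimp only at hp2 h
  subst hp2
  exact ⟨z, (key z hp).1, congrArg Prod.fst h⟩

theorem HD_dualVariety (hX : IsIrreducibleAffineCone X) : HD X = HD (dualVariety X) := by
  obtain ⟨O, hO, hd, hbij⟩ := exists_generic_bijOn_criticalPoints hX
  have hcard (u) (hu : u ∈ O) :
      (criticalPoints (dualVariety X) (star u)).encard = (criticalPoints X u).encard := by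
    rw [← (hbij u hu).image_eq, (hbij u hu).injOn.encard_image]
  ext k
  constructor
  · rintro ⟨U, hU, hne, h⟩
    -- The open set shrinks to the generic locus, which stays nonempty by density, and is conjugated
    -- since the dual data are ū.
    refine ⟨star ⁻¹' (U ∩ O), (hU.inter hO).preimage continuous_star, ?_, fun u hu => ?_⟩
    · obtain ⟨u, hu⟩ := hd.inter_open_nonempty U hU hne
      exact ⟨star u, by rwa [Set.mem_preimage, star_star]⟩
    · rw [← h _ hu.1, ← hcard _ hu.2, star_star]
  · rintro ⟨U, hU, ⟨u, hu⟩, h⟩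
    refine ⟨star ⁻¹' U ∩ O, (hU.preimage continuous_star).inter hO, ?_, fun u hu => ?_⟩
    · exact hd.inter_open_nonempty _ (hU.preimage continuous_star)
        ⟨star u, by rwa [Set.mem_preimage, star_star]⟩
    · rw [← hcard _ hu.2, h _ hu.1]

end Generic

theorem hnorm_sq_sub_add_hnorm_sq_of_mem_conjSolutions (hX : IsIrreducibleAffineCone X)
    {u : Fin n → ℂ} {p : (Fin n → ℂ) × (Fin n → ℂ)} (hp : p ∈ conjSolutions X u) :
    hnorm (u - p.1) ^ 2 + hnorm p.1 ^ 2 = hnorm u ^ 2 :=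
  hnorm_sq_sub_add_hnorm_sq
    (dotProduct_eq_zero_of_mem_conormal hX ((mem_conjSolutions_iff hX).1 hp).1)

theorem hnorm_star_sub_sub_of_mem_conjSolutions {u : Fin n → ℂ}
    {p : (Fin n → ℂ) × (Fin n → ℂ)} (hp : p ∈ conjSolutions X u) :
    hnorm (star u - (star u - p.2)) = hnorm p.1 := by
  rw [sub_sub_cancel, hp.2, hnorm_star]

end HermitianDistance

end

theorem mainTheorem2 (n : ℕ) (X : Set (Fin n → ℂ))
    (hX : HermitianDistance.IsIrreducibleAffineCone X) :
    -- the bijection between the solutions, for every `(u, v)`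
    (∀ u v : Fin n → ℂ,
      Set.BijOn (fun p : (Fin n → ℂ) × (Fin n → ℂ) => (v - p.2, u - p.1))
        (HermitianDistance.solutions X u v)
        (HermitianDistance.solutions (HermitianDistance.dualVariety X) v u)) ∧
    -- for `v = ū`, it restricts to a bijection between the solutions with `w = z̄`
    (∀ u : Fin n → ℂ,
      Set.BijOn (fun p : (Fin n → ℂ) × (Fin n → ℂ) => (star u - p.2, u - p.1))
        (HermitianDistance.conjSolutions X u)
        (HermitianDistance.conjSolutions (HermitianDistance.dualVariety X) (star u))) ∧
    -- critical points on the regular locus give such solutions, for every `u`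
    (∀ u : Fin n → ℂ, ∀ z ∈ HermitianDistance.criticalPoints X u,
      (z, star z) ∈ HermitianDistance.conjSolutions X u) ∧
    -- for generic `u`, critical points on the regular loci correspond to each other
    (∃ O : Set (Fin n → ℂ), IsOpen O ∧ Dense O ∧ ∀ u ∈ O,
      Set.BijOn (fun z : Fin n → ℂ => star u - star z)
        (HermitianDistance.criticalPoints X u)
        (HermitianDistance.criticalPoints (HermitianDistance.dualVariety X) (star u))) ∧
    -- the degrees agree; the virtual ones are really generic numbers of solutions
    (HermitianDistance.HasVHD X (HermitianDistance.vHD X) ∧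
      HermitianDistance.HasVHD (HermitianDistance.dualVariety X)
        (HermitianDistance.vHD (HermitianDistance.dualVariety X)) ∧
      HermitianDistance.vHD X =
        HermitianDistance.vHD (HermitianDistance.dualVariety X)) ∧
    HermitianDistance.HD X = HermitianDistance.HD (HermitianDistance.dualVariety X) ∧
    -- the map is proximity reversing for critical points
    (∀ u : Fin n → ℂ, ∀ p ∈ HermitianDistance.conjSolutions X u,
      HermitianDistance.hnorm (u - p.1) ^ 2 +
          HermitianDistance.hnorm (star u - (star u - p.2)) ^ 2 =
        HermitianDistance.hnorm u ^ 2 ∧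
      HermitianDistance.hnorm (u - p.1) ^ 2 + HermitianDistance.hnorm p.1 ^ 2 =
        HermitianDistance.hnorm u ^ 2) ∧
    (∀ u : Fin n → ℂ, ∀ p ∈ HermitianDistance.conjSolutions X u,
      ∀ p' ∈ HermitianDistance.conjSolutions X u,
      (HermitianDistance.hnorm (u - p.1) ≤ HermitianDistance.hnorm (u - p'.1) ↔
        HermitianDistance.hnorm (star u - (star u - p'.2)) ≤
          HermitianDistance.hnorm (star u - (star u - p.2)))) := by
  obtain ⟨k, hk⟩ := HermitianDistance.exists_hasVHD hX
  have hk' := hk.dualVariety hX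
  refine ⟨HermitianDistance.bijOn_solutions hX, HermitianDistance.bijOn_conjSolutions hX,
    fun u z hz => HermitianDistance.mem_conjSolutions_of_mem_criticalPoints hX hz,
    HermitianDistance.exists_generic_bijOn_criticalPoints hX, ?_, HermitianDistance.HD_dualVariety hX, fun u p hp => ?_,
    fun u p hp p' hp' => ?_⟩
  · rw [hk.vHD_eq, hk'.vHD_eq]
    exact ⟨hk, hk', rfl⟩
  · rw [HermitianDistance.hnorm_star_sub_sub_of_mem_conjSolutions hp]
    exact ⟨HermitianDistance.hnorm_sq_sub_add_hnorm_sq_of_mem_conjSolutions hX hp,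
      HermitianDistance.hnorm_sq_sub_add_hnorm_sq_of_mem_conjSolutions hX hp⟩
  · rw [HermitianDistance.hnorm_star_sub_sub_of_mem_conjSolutions hp, HermitianDistance.hnorm_star_sub_sub_of_mem_conjSolutions hp']
    have h1 := HermitianDistance.hnorm_sq_sub_add_hnorm_sq_of_mem_conjSolutions hX hp
    have h2 := HermitianDistance.hnorm_sq_sub_add_hnorm_sq_of_mem_conjSolutions hX hp'
    have h0 (z : Fin n → ℂ) : 0 ≤ HermitianDistance.hnorm z := norm_nonneg _
    -- Both solutions have the same sum of squared distances ‖u‖², so one square grows exactly when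
    -- the other shrinks.
    rw [← sq_le_sq₀ (h0 _) (h0 _), ← sq_le_sq₀ (h0 p'.1) (h0 _)]
    constructor <;> intro h <;> linarith
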